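/- **Setting.** Let $N,n,r,m\ge 0$ be integers with $r+m\le n<N$. Bit strings are row vectors over $\mathbb F_2$, $\oplus$ is addition, $|\cdot|$ is Hamming weight. For a bit string $\mathbf b\in\mathbb F_2^N$ let $|\mathbf i\rangle_{\mathbf b}=\bigotimes_j|i_j\rangle_{b_j}$, where $|0\rangle_0,|1\rangle_0$ is the computational basis of a qubit and $|0\rangle_1=(|0\rangle_0+|1\rangle_0)/\sqrt2$, $|1\rangle_1=(|0\rangle_0-|1\rangle_0)/\sqrt2$. *Protocol.* A generalized BB84 protocol is given by a probability distribution $\Pr(\mathbf b,\mathbf s)$ on pairs $\mathbf b,\mathbf s\in\mathbb F_2^N$ with $|\mathbf s|=n$ and by a testing function $T$ with values in $\{0,1\}$. The INFO positions are those with $s_j=1$ and the TEST positions are those with $s_j=0$; for $\mathbf x\in\mathbb F_2^N$, $\mathbf x_{\mathrm I}\in\mathbb F_2^n$ and $\mathbf x_{\mathrm T}\in\mathbb F_2^{N-n}$ are the corresponding substrings. Alice chooses $\mathbf i\in\mathbb F_2^N$ uniformly, $(\mathbf b,\mathbf s)$ with law $\Pr(\mathbf b,\mathbf s)$, and, uniformly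 among all pairs whose $r+m$ rows together are linearly independent, matrices $P_{\mathrm C}\in\mathbb F_2^{r\times n}$ and $P_{\mathrm K}\in\mathbb F_2^{m\times n}$; all these choices are independent of each other. She sends $|\mathbf i\rangle_{\mathbf b}$; Bob measures the qubits he receives in the basis $\{|\mathbf j\rangle_{\mathbf b}\}_{\mathbf j}$ and obtains $\mathbf j$. Put $\mathbf c=\mathbf i\oplus\mathbf j$, let $\boldsymbol\xi=\mathbf i_{\mathrm I}P_{\mathrm C}^{\mathsf T}\in\mathbb F_2^r$ be the syndrome and $\mathbf k=\mathbf i_{\mathrm I}P_{\mathrm K}^{\mathsf T}\in\mathbb F_2^m$ the final key. The test passes ($\mathbf T=1$) if $T(\mathbf c_{\mathrm T},\mathbf b_{\mathrm T},\mathbf s)=1$. In the hypothetical *inverted-INFO-basis* protocol everything is chosen in the same way, but $\mathbf b\oplus\mathbf s$ is used in place of $\mathbf b$ as the basis string for sending and measuring. *Attack.* Eve's joint attack consists of a probe Hilbert space $\mathrm E$, a unit vector $|0\rangle_{\mathrm E}$, and a unitary $U$ on $\mathrm E\otimes(\mathbb C^2)^{\otimes N}$ applied before Bob's measurement; write $U|0\rangle_{\mathrm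 E}|\mathbf i\rangle_{\mathbf b}=\sum_{\mathbf j}|E'_{\mathbf i,\mathbf j}\rangle_{\mathbf b}|\mathbf j\rangle_{\mathbf b}$, so $\Pr(\mathbf j\mid\mathbf i,\mathbf b,\mathbf s)=\langle E'_{\mathbf i,\mathbf j}|E'_{\mathbf i,\mathbf j}\rangle_{\mathbf b}$. The *symmetrized* attack has probe $\mathrm E\otimes\mathrm M$, $\mathrm M=(\mathbb C^2)^{\otimes N}$, initial probe state $|0\rangle_{\mathrm E}\otimes2^{-N/2}\sum_{\mathbf m\in\mathbb F_2^N}|\mathbf m\rangle_{\mathrm M}$, and unitary $(\mathbf I_{\mathrm E}\otimes S^\dagger)(U\otimes\mathbf I_{\mathrm M})(\mathbf I_{\mathrm E}\otimes S)$, where $S|\mathbf i\rangle_{\mathbf b}|\mathbf m\rangle_{\mathrm M}=(-1)^{(\mathbf i\oplus\mathbf b)\cdot\mathbf m}|\mathbf i\oplus\mathbf m\rangle_{\mathbf b}|\mathbf m\rangle_{\mathrm M}$ (the same operator $S$ for every $\mathbf b$). The superscript $\mathrm{sym}$ refers to this attack. *Eve's states.* Given $\mathbf i_{\mathrm T},\mathbf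 j_{\mathrm T},\mathbf b,\mathbf s$, put $|E^{\mathrm{sym}}_{\mathbf i_{\mathrm I},\mathbf j_{\mathrm I}}\rangle=\Pr^{\mathrm{sym}}(\mathbf j_{\mathrm T}\mid\mathbf i_{\mathrm I},\mathbf i_{\mathrm T},\mathbf b,\mathbf s)^{-1/2}\,|E'^{\,\mathrm{sym}}_{\mathbf i,\mathbf j}\rangle_{\mathbf b}$, $\rho^{\mathbf i_{\mathrm I}}=\sum_{\mathbf j_{\mathrm I}}|E^{\mathrm{sym}}_{\mathbf i_{\mathrm I},\mathbf j_{\mathrm I}}\rangle\langle E^{\mathrm{sym}}_{\mathbf i_{\mathrm I},\mathbf j_{\mathrm I}}|$ (values of $\mathbf i_{\mathrm T},\mathbf j_{\mathrm T}$ for which the conditional probability vanishes have total weight zero below), and, for a syndrome $\boldsymbol\xi$ and a key $\mathbf k$, $$\widehat\rho^{\,\mathrm{sym}}_{\mathbf k}=\frac1{2^{n-r-m}}\sum_{\substack{P_{\mathrm C},P_{\mathrm K},\mathbf i_{\mathrm I}:\\ \mathbf i_{\mathrm I}P_{\mathrm C}^{\mathsf T}=\boldsymbol\xi,\ \mathbf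 i_{\mathrm I}P_{\mathrm K}^{\mathsf T}=\mathbf k}}\Pr(P_{\mathrm C},P_{\mathrm K})\;\rho^{\mathbf i_{\mathrm I}}\otimes|P_{\mathrm C},P_{\mathrm K}\rangle\langle P_{\mathrm C},P_{\mathrm K}|,$$ the vectors $|P_{\mathrm C},P_{\mathrm K}\rangle$ being orthonormal. Let $\Delta^{\mathrm{sym}}_{\mathrm{Eve}}(\mathbf k,\mathbf k'\mid\mathbf i_{\mathrm T},\mathbf j_{\mathrm T},\mathbf b,\mathbf s,\boldsymbol\xi)=\frac12\operatorname{tr}|\widehat\rho^{\,\mathrm{sym}}_{\mathbf k}-\widehat\rho^{\,\mathrm{sym}}_{\mathbf k'}|$ if $T(\mathbf i_{\mathrm T}\oplus\mathbf j_{\mathrm T},\mathbf b_{\mathrm T},\mathbf s)=1$ and $0$ otherwise, and let $$\langle\Delta^{\mathrm{sym}}_{\mathrm{Eve}}(\mathbf k,\mathbf k')\rangle=\sum_{\mathbf i_{\mathrm T},\mathbf j_{\mathrm T},\mathbf b,\mathbf s,\boldsymbol\xi}\Delta^{\mathrm{sym}}_{\mathrm{Eve}}(\mathbf k,\mathbf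 k'\mid\mathbf i_{\mathrm T},\mathbf j_{\mathrm T},\mathbf b,\mathbf s,\boldsymbol\xi)\cdot\Pr{}^{\mathrm{sym}}(\mathbf i_{\mathrm T},\mathbf j_{\mathrm T},\mathbf b,\mathbf s,\boldsymbol\xi).$$ **Theorem.** For every generalized BB84 protocol, every joint attack, any two keys $\mathbf k,\mathbf k'\in\mathbb F_2^m$ and any integer $0\le t\le\frac n2$, $$\langle\Delta^{\mathrm{sym}}_{\mathrm{Eve}}(\mathbf k,\mathbf k')\rangle\le2m\sqrt{\Pr{}_{\text{inverted-INFO-basis}}\!\left[\left(\tfrac{|\mathbf C_{\mathrm I}|}n\ge\tfrac tn\right)\wedge(\mathbf T=1)\right]+2^{\,n\left[H_2(t/n)-(n-r-m)/n\right]}},$$ where $\mathbf C_{\mathrm I}$ is the random error string $\mathbf c_{\mathrm I}=\mathbf i_{\mathrm I}\oplus\mathbf j_{\mathrm I}$, $H_2(x)=-x\log_2x-(1-x)\log_2(1-x)$ with $0\log_20=0$, and the probability on the right is taken in the inverted-INFO-basis protocol under the original (non-symmetrized) attack. (For $n=0$, which forces $m=0$, both sides are $0$.) -/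

import Mathlib

open scoped ENNReal Matrix

noncomputable section

namespace GenBB84

/-! ### Bit strings, and the split into INFO and TEST bits -/

/-- Bit strings of length `N`, as row vectors over `𝔽₂`; addition is XOR and the number of
1-bits is `hammingNorm`. -/
abbrev BitStr (N : ℕ) : Type := Fin N → ZMod 2

/-- The strings `s` of length `N` with exactly `n` ones: `s p = 1` marks an INFO bit and
`s p = 0` marks a TEST bit. -/
abbrev Sel (N n : ℕ) : Type := {s : BitStr N // hammingNorm s = n}

/-- The set of INFO positions. -/
def infoSet {N n : ℕ} (s : Sel N n) : Finset (Fin N) := Finset.univ.filter fun p => s.1 p ≠ 0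

theorem card_infoSet {N n : ℕ} (s : Sel N n) : (infoSet s).card = n := s.2

theorem card_testSet {N n : ℕ} (s : Sel N n) : (infoSet s)ᶜ.card = N - n := by
  rw [Finset.card_compl, card_infoSet, Fintype.card_fin]

/-- The increasing enumerations of the `n` INFO positions and of the `N - n` TEST positions. -/
def splitPos {N n : ℕ} (s : Sel N n) : Fin n ⊕ Fin (N - n) ≃ Fin N :=
  finSumEquivOfFinset (card_infoSet s) (card_testSet s)

/-- The INFO substring `x_I`. -/
def infoPart {N n : ℕ} (s : Sel N n) (x : BitStr N) : BitStr n :=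
  fun p => x (splitPos s (Sum.inl p))

/-- The TEST substring `x_T`. -/
def testPart {N n : ℕ} (s : Sel N n) (x : BitStr N) : BitStr (N - n) :=
  fun p => x (splitPos s (Sum.inr p))

/-- The string with INFO part `u` and TEST part `v`. -/
def join {N n : ℕ} (s : Sel N n) (u : BitStr n) (v : BitStr (N - n)) : BitStr N :=
  fun p => Sum.elim u v ((splitPos s).symm p)

/-- The sign `(-1)^a` of a bit `a`. -/
def sgn (a : ZMod 2) : ℂ := if a = 0 then 1 else -1

/-! ### Quantum registers -/

/-- The Hilbert space `E ⊗ ℂ^X`, where `ℂ^X` has the orthonormal (computational) basis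
`(|x⟩)_{x ∈ X}`: the vector `∑ₓ f x ⊗ |x⟩` is the family `f`, with
`‖f‖² = ∑ₓ ‖f x‖²`. -/
abbrev Reg (X : Type) (E : Type*) : Type _ := PiLp 2 (fun _ : X => E)

/-- The amplitude `⟨q|i⟩_b` of the qubit state `|i⟩_b` in the computational basis; the `z` basis
is `b = 0` and the `x` (Hadamard) basis is `b = 1`. -/
def qubitAmp (b i q : ZMod 2) : ℂ :=
  if b = 0 then (if q = i then 1 else 0) else sgn (i * q) / (Real.sqrt 2 : ℂ)

/-- The amplitude `⟨q|i⟩_b` of the `N`-qubit product state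
`|i⟩_b = |i₁⟩_{b₁} ⊗ ⋯ ⊗ |i_N⟩_{b_N}`. -/
def ketAmp {N : ℕ} (b i q : BitStr N) : ℂ := ∏ p, qubitAmp (b p) (i p) (q p)

section Registers

variable {E : Type*} [NormedAddCommGroup E] [InnerProductSpace ℂ E]

/-- The vector `e ⊗ |i⟩_b`. -/
def withKet {N : ℕ} (e : E) (b i : BitStr N) : Reg (BitStr N) E :=
  WithLp.toLp 2 fun q => ketAmp b i q • e

/-- The partial inner product `(1 ⊗ ⟨j|_b) f`, a vector of `E`. -/
def bra {N : ℕ} (b j : BitStr N) (f : Reg (BitStr N) E) : E :=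
  ∑ q, (starRingEnd ℂ) (ketAmp b j q) • f q

/-- Exchange of two registers. -/
def swapReg (X Y : Type) [Fintype X] [Fintype Y] (E : Type*) [NormedAddCommGroup E]
    [InnerProductSpace ℂ E] : Reg X (Reg Y E) ≃ₗᵢ[ℂ] Reg Y (Reg X E) where
  toFun f := WithLp.toLp 2 fun y => WithLp.toLp 2 fun x => f x y
  invFun f := WithLp.toLp 2 fun x => WithLp.toLp 2 fun y => f y x
  map_add' _ _ := rfl
  map_smul' _ _ := rfl
  left_inv _ := rfl
  right_inv _ := rfl
  norm_map' f := by
    rw [← sq_eq_sq₀ (norm_nonneg _) (norm_nonneg _)]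
    simp only [PiLp.norm_sq_eq_of_L2]
    exact Finset.sum_comm

/-- The unitary on `E ⊗ ℂ^X ⊗ ℂ^Y` that applies `V y` to `E ⊗ ℂ^X` when the register `Y` is in
the basis state `|y⟩`. -/
def controlled {X Y : Type} [Fintype X] [Fintype Y] (V : Y → (Reg X E ≃ₗᵢ[ℂ] Reg X E)) :
    Reg X (Reg Y E) ≃ₗᵢ[ℂ] Reg X (Reg Y E) :=
  ((swapReg X Y E).trans (LinearIsometryEquiv.piLpCongrRight 2 V)).trans (swapReg Y X E)

/-- The unitary `e ⊗ |i⟩ ↦ (-1)^{i · m} e ⊗ |i ⊕ m⟩` (computational basis kets). -/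
def twist (E : Type*) [NormedAddCommGroup E] [InnerProductSpace ℂ E] {N : ℕ} (m : BitStr N) :
    Reg (BitStr N) E ≃ₗᵢ[ℂ] Reg (BitStr N) E :=
  (LinearIsometryEquiv.piLpCongrRight 2 fun i : BitStr N =>
      if i ⬝ᵥ m = 0 then LinearIsometryEquiv.refl ℂ E else LinearIsometryEquiv.neg ℂ).trans
    (LinearIsometryEquiv.piLpCongrLeft 2 ℂ E (Equiv.addRight m))

/-- The symmetrization unitary `S` on Alice's qubits and the register `M`; see `symS_apply`. -/
def symS (E : Type*) [NormedAddCommGroup E] [InnerProductSpace ℂ E] (N : ℕ) :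
    Reg (BitStr N) (Reg (BitStr N) E) ≃ₗᵢ[ℂ] Reg (BitStr N) (Reg (BitStr N) E) :=
  controlled fun m => twist E m

theorem bit_cases : ∀ a : ZMod 2, a = 0 ∨ a = 1 := by decide

theorem bit_one_add_one : (1 : ZMod 2) + 1 = 0 := by decide

theorem sgn_add (a c : ZMod 2) : sgn (a + c) = sgn a * sgn c := by
  rcases bit_cases a with rfl | rfl <;> rcases bit_cases c with rfl | rfl <;>
    simp [sgn, bit_one_add_one]

theorem sgn_sum {ι : Type*} (t : Finset ι) (f : ι → ZMod 2) :
    sgn (∑ p ∈ t, f p) = ∏ p ∈ t, sgn (f p) := by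
  classical
  induction t using Finset.induction_on with
  | empty => simp [sgn]
  | insert a t ha ih => rw [Finset.sum_insert ha, Finset.prod_insert ha, sgn_add, ih]

theorem qubitAmp_twist (b i q m : ZMod 2) :
    sgn ((q + m) * m) * qubitAmp b i (q + m) = sgn ((i + b) * m) * qubitAmp b (i + m) q := by
  rcases bit_cases b with rfl | rfl <;> rcases bit_cases i with rfl | rfl <;>
    rcases bit_cases q with rfl | rfl <;> rcases bit_cases m with rfl | rfl <;>
    simp [sgn, qubitAmp, bit_one_add_one, neg_div]

theorem ketAmp_twist {N : ℕ} (b i q m : BitStr N) :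
    sgn ((q + m) ⬝ᵥ m) * ketAmp b i (q + m) = sgn ((i + b) ⬝ᵥ m) * ketAmp b (i + m) q := by
  simp only [dotProduct, sgn_sum, ketAmp, ← Finset.prod_mul_distrib]
  exact Finset.prod_congr rfl fun p _ => qubitAmp_twist _ _ _ _

theorem symS_coord {N : ℕ} (f : Reg (BitStr N) (Reg (BitStr N) E)) (q m : BitStr N) :
    symS E N f q m = sgn ((q + m) ⬝ᵥ m) • f (q + m) m := by
  have hq : q - m = q + m := by
    funext p
    rw [Pi.sub_apply, Pi.add_apply, sub_eq_add_neg, ZMod.neg_eq_self_mod_two]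
  have h : symS E N f q m = (if (q - m) ⬝ᵥ m = 0 then LinearIsometryEquiv.refl ℂ E
      else LinearIsometryEquiv.neg ℂ) (f (q - m) m) := by
    simp only [sub_eq_add_neg]
    rfl
  rw [h, hq]
  unfold sgn
  split_ifs <;> simp

/-- `S |i⟩_b |m⟩_M = (-1)^{(i ⊕ b) · m} |i ⊕ m⟩_b |m⟩_M` for every basis string `b`. -/
theorem symS_apply {N : ℕ} (e : E) (b i m : BitStr N) :
    symS E N (withKet (PiLp.single 2 m e) b i) =
      sgn ((i + b) ⬝ᵥ m) • withKet (PiLp.single 2 m e) b (i + m) := by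
  ext q m'
  rw [symS_coord]
  by_cases h : m' = m
  · subst h
    simp only [withKet, PiLp.smul_apply, smul_smul, ketAmp_twist]
  · simp [withKet, h]

end Registers

/-! ### Eve's joint attack and its symmetrization -/

/-- A joint attack on `N` qubits: a probe with Hilbert space `E`, its normalized initial state
`|0⟩_E`, and a unitary `U` on the compound system of the probe and Alice's qubits. -/
structure Attack (N : ℕ) (E : Type*) [NormedAddCommGroup E] [InnerProductSpace ℂ E] where
  probe : E
  norm_probe : ‖probe‖ = 1
  U : Reg (BitStr N) E ≃ₗᵢ[ℂ] Reg (BitStr N) E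

section Attacks

variable {N : ℕ} {E : Type*} [NormedAddCommGroup E] [InnerProductSpace ℂ E]

/-- The non-normalized probe states `|E'_{i,j}⟩_b`; see `Attack.sum_eve`. -/
def Attack.eve (A : Attack N E) (b i j : BitStr N) : E := bra b j (A.U (withKet A.probe b i))

/-- The state `|0_x⟩ = 2^{-N/2} ∑ₘ |m⟩` of the register `M`, next to the probe state `e`. -/
def withPlus (N : ℕ) (e : E) : Reg (BitStr N) E :=
  WithLp.toLp 2 fun _ => ((1 / Real.sqrt (2 ^ N) : ℝ) : ℂ) • e

theorem norm_withPlus (N : ℕ) (e : E) : ‖withPlus N e‖ = ‖e‖ := by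
  rw [← sq_eq_sq₀ (norm_nonneg _) (norm_nonneg _), PiLp.norm_sq_eq_of_L2]
  have h : (Real.sqrt (2 ^ N)) ^ 2 = 2 ^ N := Real.sq_sqrt (by positivity)
  simp [withPlus, norm_smul, mul_pow, inv_pow, h]

/-- The symmetrized attack: the probe is `E ⊗ M`, the register `M` starts in `|0_x⟩`, and the
unitary is `(1 ⊗ S†)(U ⊗ 1_M)(1 ⊗ S)`. -/
def Attack.symmetrize (A : Attack N E) : Attack N (Reg (BitStr N) E) where
  probe := withPlus N A.probe
  norm_probe := (norm_withPlus N A.probe).trans A.norm_probe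
  U := ((symS E N).trans (controlled fun _ => A.U)).trans (symS E N).symm

theorem sum_qubitAmp (b q q' : ZMod 2) :
    ∑ j, qubitAmp b j q * (starRingEnd ℂ) (qubitAmp b j q') = if q = q' then 1 else 0 := by
  have h : ((Real.sqrt 2 : ℝ) : ℂ) * ((Real.sqrt 2 : ℝ) : ℂ) = 2 := by
    rw [← Complex.ofReal_mul, Real.mul_self_sqrt (by norm_num)]; norm_num
  have h2 : ((Real.sqrt 2 : ℝ) : ℂ)⁻¹ * ((Real.sqrt 2 : ℝ) : ℂ)⁻¹ = 1 / 2 := by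
    rw [← mul_inv, h]; norm_num
  have hu : (Finset.univ : Finset (ZMod 2)) = {0, 1} := by decide
  rw [hu, Finset.sum_pair (by decide)]
  rcases bit_cases b with rfl | rfl <;> rcases bit_cases q with rfl | rfl <;>
    rcases bit_cases q' with rfl | rfl <;>
    simp [sgn, qubitAmp, div_eq_mul_inv, h2] <;> norm_num

theorem sum_ketAmp (b q q' : BitStr N) :
    ∑ j, ketAmp b j q * (starRingEnd ℂ) (ketAmp b j q') = if q = q' then 1 else 0 := by
  simp only [ketAmp, map_prod, ← Finset.prod_mul_distrib]
  rw [← Fintype.piFinset_univ, ← Finset.prod_univ_sum (fun _ => Finset.univ)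
    (fun p a => qubitAmp (b p) a (q p) * (starRingEnd ℂ) (qubitAmp (b p) a (q' p)))]
  simp only [sum_qubitAmp, Finset.prod_ite_zero, Finset.mem_univ, true_imp_iff, funext_iff,
    Finset.prod_const_one]

/-- `U |0⟩_E |i⟩_b = ∑ⱼ |E'_{i,j}⟩_b |j⟩_b`. -/
theorem Attack.sum_eve (A : Attack N E) (b i : BitStr N) :
    A.U (withKet A.probe b i) = ∑ j, withKet (A.eve b i j) b j := by
  ext q
  simp only [WithLp.ofLp_sum, Finset.sum_apply, withKet, Attack.eve, bra, Finset.smul_sum,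
    smul_smul]
  rw [Finset.sum_comm]
  simp only [← Finset.sum_smul, sum_ketAmp]
  simp

end Attacks

/-! ### Generalized BB84 protocols -/

/-- The pairs `(P_C, P_K)` of an `r × n` and an `m × n` matrix. -/
abbrev KeyMat (n r m : ℕ) : Type := Matrix (Fin r) (Fin n) (ZMod 2) × Matrix (Fin m) (Fin n) (ZMod 2)

/-- All `r + m` rows of the two matrices together are linearly independent. -/
def KeyMat.Valid {n r m : ℕ} (P : KeyMat n r m) : Prop :=
  LinearIndependent (ZMod 2) (Matrix.fromRows P.1 P.2).row

open Classical in
/-- The uniform distribution on the valid pairs `(P_C, P_K)`. -/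
def matProb {n r m : ℕ} (P : KeyMat n r m) : ℝ :=
  if P.Valid then 1 / ((Finset.univ.filter fun P' : KeyMat n r m => P'.Valid).card : ℝ) else 0

/-- The data that single out a generalized BB84 protocol with `N` qubits and `n` INFO bits: the
joint distribution `Pr(b, s)` of the basis string and of the INFO/TEST string (its support is the
set of allowed pairs), and the testing function `T(c_T, b_T, s)`; the test passes when it is `true`.
-/
structure Protocol (N n : ℕ) where
  prob : BitStr N → Sel N n → ℝ
  prob_nonneg : ∀ b s, 0 ≤ prob b s
  prob_sum : ∑ b, ∑ s, prob b s = 1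
  T : BitStr (N - n) → BitStr (N - n) → Sel N n → Bool

/-- The outcome of one run: Alice's string `i`, Bob's string `j`, the *chosen* strings `b` and `s`,
and the chosen matrices. -/
structure Run (N n r m : ℕ) where
  i : BitStr N
  j : BitStr N
  b : BitStr N
  s : Sel N n
  P : KeyMat n r m

namespace Run

variable {N n r m : ℕ}

/-- The error string `c = i ⊕ j`. -/
def c (ω : Run N n r m) : BitStr N := ω.i + ω.j

/-- The syndrome `ξ = i_I P_Cᵀ`. -/
def syndrome (ω : Run N n r m) : BitStr r := infoPart ω.s ω.i ᵥ* ω.P.1ᵀ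

end Run

/-- Runs as tuples. -/
def runEquiv (N n r m : ℕ) :
    Run N n r m ≃ BitStr N × BitStr N × BitStr N × Sel N n × KeyMat n r m where
  toFun ω := (ω.i, ω.j, ω.b, ω.s, ω.P)
  invFun x := ⟨x.1, x.2.1, x.2.2.1, x.2.2.2.1, x.2.2.2.2⟩
  left_inv _ := rfl
  right_inv _ := rfl

instance (N n r m : ℕ) : Fintype (Run N n r m) := Fintype.ofEquiv _ (runEquiv N n r m).symm

namespace Protocol

variable {N n r m : ℕ} {E : Type*} [NormedAddCommGroup E] [InnerProductSpace ℂ E]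

/-- The test passes, `T(c_T, b_T, s) = 1`. -/
def Passes (Q : Protocol N n) (ω : Run N n r m) : Prop :=
  Q.T (testPart ω.s ω.c) (testPart ω.s ω.b) ω.s = true

/-- The probability of a run when the qubits are sent and measured in the basis string `use b s`:
`i` is uniform, `(b, s)` has law `Pr(b, s)`, the matrices are uniform, and Bob measures `j` with
probability `⟨E'_{i,j}|E'_{i,j}⟩`. -/
def runProb (Q : Protocol N n) (A : Attack N E) (use : BitStr N → Sel N n → BitStr N)
    (ω : Run N n r m) : ℝ :=
  1 / 2 ^ N * Q.prob ω.b ω.s * matProb ω.P * ‖A.eve (use ω.b ω.s) ω.i ω.j‖ ^ 2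

open Classical in
/-- Probabilities of events in the real protocol, which uses the basis string `b`. -/
def Pr (Q : Protocol N n) (A : Attack N E) (ev : Set (Run N n r m)) : ℝ :=
  ∑ ω with ω ∈ ev, Q.runProb A (fun b _ => b) ω

open Classical in
/-- Probabilities of events in the inverted-INFO-basis protocol, which chooses `b` and `s` in the
same way and uses the basis string `b ⊕ s`. -/
def PrInv (Q : Protocol N n) (A : Attack N E) (ev : Set (Run N n r m)) : ℝ :=
  ∑ ω with ω ∈ ev, Q.runProb A (fun b s => b + s.1) ω

end Protocol

/-! ### Trace distance -/

section TraceNorm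

/-- The trace norm `tr |D| = ∑ₖ ⟨eₖ, |D| eₖ⟩ ∈ [0, ∞]` of a bounded operator, where
`|D| = √(D†D)` and `(eₖ)` is a Hilbert basis. -/
def traceNorm {H : Type*} [NormedAddCommGroup H] [InnerProductSpace ℂ H] [CompleteSpace H]
    (D : H →L[ℂ] H) : ℝ≥0∞ :=
  ∑' e : (exists_hilbertBasis ℂ H).choose,
    ENNReal.ofReal (RCLike.re (inner ℂ (e : H) (CFC.abs D (e : H))))

variable {E : Type*} [NormedAddCommGroup E] [InnerProductSpace ℂ E]

/-- The operator `ρ ⊗ |x⟩⟨x|` on `E ⊗ ℂ^X`. -/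
def tensorKet {X : Type} [Fintype X] [DecidableEq X] (ρ : E →L[ℂ] E) (x : X) :
    Reg X E →L[ℂ] Reg X E :=
  ((LinearIsometry.toContinuousLinearMap
      { toFun := fun v => PiLp.single 2 x v
        map_add' := fun _ _ => PiLp.single_add 2 x
        map_smul' := fun c v => by
          ext y; by_cases h : y = x
          · subst h; simp
          · simp [h]
        norm_map' := fun v => PiLp.norm_single 2 (fun _ : X => E) x v } : E →L[ℂ] Reg X E).comp
    ρ).comp (PiLp.proj 2 (fun _ : X => E) x : Reg X E →L[ℂ] E)

end TraceNorm

/-! ### Eve's states and the expected trace distance -/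

namespace Attack

variable {N n : ℕ} {E : Type*} [NormedAddCommGroup E] [InnerProductSpace ℂ E]

/-- `Pr(j_T | i_I, i_T, b, s)`. -/
def testProb (A : Attack N E) (b : BitStr N) (s : Sel N n) (iI : BitStr n)
    (iT jT : BitStr (N - n)) : ℝ :=
  ∑ jI, ‖A.eve b (join s iI iT) (join s jI jT)‖ ^ 2

/-- `|E_{i_I,j_I}⟩_{b,s}`, which depends on `i_T, j_T` as well. -/
def eveInfo (A : Attack N E) (b : BitStr N) (s : Sel N n) (iT jT : BitStr (N - n))
    (iI jI : BitStr n) : E :=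
  ((1 / Real.sqrt (A.testProb b s iI iT jT) : ℝ) : ℂ) • A.eve b (join s iI iT) (join s jI jT)

/-- Eve's state `ρ^{i_I}` after the attack, with Bob's INFO qubits traced out, given
`i_T, j_T, b, s`. -/
def rho (A : Attack N E) (b : BitStr N) (s : Sel N n) (iT jT : BitStr (N - n)) (iI : BitStr n) :
    E →L[ℂ] E :=
  ∑ jI, InnerProductSpace.rankOne ℂ (A.eveInfo b s iT jT iI jI) (A.eveInfo b s iT jT iI jI)

open Classical in
/-- Eve's state `ρ̂_k` given the final key `k` and `i_T, j_T, b, s, ξ`, including the published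
matrices as classical information. -/
def rhoKey {r m : ℕ} (A : Attack N E) (b : BitStr N) (s : Sel N n) (iT jT : BitStr (N - n))
    (ξ : BitStr r) (k : BitStr m) : Reg (KeyMat n r m) E →L[ℂ] Reg (KeyMat n r m) E :=
  ((1 / 2 ^ (n - r - m) : ℝ) : ℂ) • ∑ P : KeyMat n r m,
    ∑ iI with iI ᵥ* P.1ᵀ = ξ ∧ iI ᵥ* P.2ᵀ = k,
      ((matProb P : ℝ) : ℂ) • tensorKet (A.rho b s iT jT iI) P

end Attack

namespace Protocol

variable {N n r m : ℕ} {E : Type*} [NormedAddCommGroup E] [InnerProductSpace ℂ E]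
  [CompleteSpace E]

/-- `Δ_Eve(k, k' | i_T, j_T, b, s, ξ)`: the trace distance of Eve's states for the keys `k` and `k'`
if the test passes, and `0` otherwise. -/
def delta (Q : Protocol N n) (A : Attack N E) (k k' : BitStr m) (iT jT : BitStr (N - n))
    (b : BitStr N) (s : Sel N n) (ξ : BitStr r) : ℝ≥0∞ :=
  if Q.T (iT + jT) (testPart s b) s = true then
    2⁻¹ * traceNorm (A.rhoKey b s iT jT ξ k - A.rhoKey b s iT jT ξ k')
  else 0

/-- The expectation `⟨Δ_Eve(k, k')⟩` over `i_T, j_T, b, s, ξ` in the real protocol with attack `A`;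
`r` is the number of syndrome bits. -/
def expectedDelta (Q : Protocol N n) (A : Attack N E) (r : ℕ) (k k' : BitStr m) : ℝ≥0∞ :=
  ∑ iT : BitStr (N - n), ∑ jT : BitStr (N - n), ∑ b : BitStr N, ∑ s : Sel N n, ∑ ξ : BitStr r,
    Q.delta A k k' iT jT b s ξ *
      ENNReal.ofReal (Q.Pr A {ω : Run N n r m | testPart ω.s ω.i = iT ∧ testPart ω.s ω.j = jT ∧
        ω.b = b ∧ ω.s = s ∧ ω.syndrome = ξ})

end Protocol

/-- The binary entropy `H₂(x) = -x log₂ x - (1 - x) log₂ (1 - x)`. -/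
def H₂ (x : ℝ) : ℝ := -x * Real.logb 2 x - (1 - x) * Real.logb 2 (1 - x)

end GenBB84

end

/-! Fix the TEST bits and keep Bob's INFO error string as an extra register. The symmetrized probe
states ψ_i (`Attack.symVec`) then form a Fourier series ψ_i = Σ_l (-1)^{i·l} η_l whose coefficients
η_l are pairwise orthogonal (`Attack.inner_symFourier`): the INFO part of the mask in M enters η_l
only through a character, and the TEST part averages over Alice's TEST string. Inverting the basis
of the INFO qubits is a Hadamard transform, so ‖η_l‖² is the joint probability of the INFO error l
and the TEST error c_T when the original attack meets inverted INFO bits (`Attack.sum_eve_add_sel`).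

For fixed matrices, Eve's state for a key is a mixture over a coset of strings. Parseval turns it
into a sum over l of rank-one operators built from v_l = Σ_{i in the coset} (-1)^{i·l} ψ_i, and v_l
is a constant times Σ_z (-1)^{z·(ξ,k)} η_{l+zP}. Replacing k by k' (and v by w) flips the signs with
z·a = 1, where a = (0, k+k'). So v+w and v-w live on the two halves of the coset of l modulo the row
space, and the trace norm of |v⟩⟨v| - |w⟩⟨w| is at most ‖v+w‖‖v-w‖, a constant times √(xy) for the
weights x, y of the halves (`norm_coset_sum_mul_norm_coset_sum`).

Now xy ≤ (x+y) min(x,y), and the half that avoids a lightest string of the coset consists of strings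
that minimum-weight decoding could confuse (`min_halfWeight_le`). Cauchy–Schwarz leaves the expected
weight of these ambiguous strings. As for random linear codes, a string lighter than t is ambiguous
only if its difference from another string lighter than t is a suitable combination of rows; there
are at most 2^{n H₂(t/n)} such strings (`card_weight_lt_le`), each with probability at most
2^{r+m-n} (`sum_matProb_exists_comb_le`). A last Cauchy–Schwarz over b, s, c_T
(`Protocol.sum_sqrt_le`) gives the bound.

The whole key is handled at once, without a hybrid argument over its bits, so the constant obtained
is 2 instead of 2m. -/

noncomputable section

namespace GenBB84

/-! ### A bound for the trace norm -/

section TraceBound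

variable {H : Type*} [NormedAddCommGroup H] [InnerProductSpace ℂ H]

/-- `|tr (V D)|` is bounded by `c`, in each finite orthonormal family and for each contraction `V`. -/
def TraceLE (D : H →L[ℂ] H) (c : ℝ) : Prop :=
  ∀ V : H →L[ℂ] H, ‖V‖ ≤ 1 → ∀ w : Set H, Orthonormal ℂ ((↑) : w → H) → ∀ s : Finset w,
    ∑ e ∈ s, RCLike.re (inner ℂ (e : H) (V (D e))) ≤ c

theorem TraceLE.add {D D' : H →L[ℂ] H} {c c' : ℝ} (h : TraceLE D c) (h' : TraceLE D' c') :
    TraceLE (D + D') (c + c') := by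
  intro V hV w hw s
  simp only [add_apply, map_add, inner_add_right, Finset.sum_add_distrib]
  exact add_le_add (h V hV w hw s) (h' V hV w hw s)

theorem TraceLE.zero : TraceLE (0 : H →L[ℂ] H) 0 := by
  intro V hV w hw s
  simp

theorem TraceLE.sum {ι : Type*} (t : Finset ι) (D : ι → H →L[ℂ] H) (c : ι → ℝ)
    (h : ∀ i ∈ t, TraceLE (D i) (c i)) : TraceLE (∑ i ∈ t, D i) (∑ i ∈ t, c i) := by
  classical
  induction t using Finset.induction_on with
  | empty => simpa using TraceLE.zero
  | insert a t ha ih =>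
    rw [Finset.sum_insert ha, Finset.sum_insert ha]
    exact (h a (Finset.mem_insert_self a t)).add
      (ih fun i hi => h i (Finset.mem_insert_of_mem hi))

theorem TraceLE.smul {D : H →L[ℂ] H} {c : ℝ} (h : TraceLE D c) {a : ℝ} (ha : 0 ≤ a) :
    TraceLE ((a : ℂ) • D) (a * c) := by
  intro V hV w hw s
  have : ∀ e : w, RCLike.re (inner ℂ (e : H) (V (((a : ℂ) • D) e)))
      = a * RCLike.re (inner ℂ (e : H) (V (D e))) := by
    intro e
    simp
  simp only [this, ← Finset.mul_sum]
  exact mul_le_mul_of_nonneg_left (h V hV w hw s) ha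

theorem TraceLE.mono {D : H →L[ℂ] H} {c c' : ℝ} (h : TraceLE D c) (hc : c ≤ c') :
    TraceLE D c' := fun V hV w hw s => (h V hV w hw s).trans hc

/-- Cauchy–Schwarz over the family, followed by Bessel's inequality for V x and for y. -/
theorem traceLE_rankOne (x y : H) : TraceLE (InnerProductSpace.rankOne ℂ x y) (‖x‖ * ‖y‖) := by
  intro V hV w hw s
  have h1 : ∀ z : H, ∑ e ∈ s, ‖inner ℂ (e : H) z‖ ^ 2 ≤ ‖z‖ ^ 2 := fun z =>
    hw.sum_inner_products_le z
  calc ∑ e ∈ s, RCLike.re (inner ℂ (e : H) (V (InnerProductSpace.rankOne ℂ x y e)))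
      ≤ ∑ e ∈ s, ‖inner ℂ (e : H) (V x)‖ * ‖inner ℂ (e : H) y‖ := by
        refine Finset.sum_le_sum fun e _ => (RCLike.re_le_norm _).trans (le_of_eq ?_)
        rw [InnerProductSpace.rankOne_apply, map_smul, inner_smul_right, norm_mul, mul_comm,
          norm_inner_symm y]
    _ ≤ Real.sqrt (∑ e ∈ s, ‖inner ℂ (e : H) (V x)‖ ^ 2) *
          Real.sqrt (∑ e ∈ s, ‖inner ℂ (e : H) y‖ ^ 2) := Real.sum_mul_le_sqrt_mul_sqrt _ _ _
    _ ≤ Real.sqrt (‖V x‖ ^ 2) * Real.sqrt (‖y‖ ^ 2) :=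
        mul_le_mul (Real.sqrt_le_sqrt (h1 _)) (Real.sqrt_le_sqrt (h1 _)) (Real.sqrt_nonneg _)
          (Real.sqrt_nonneg _)
    _ = ‖V x‖ * ‖y‖ := by rw [Real.sqrt_sq (norm_nonneg _), Real.sqrt_sq (norm_nonneg _)]
    _ ≤ ‖x‖ * ‖y‖ := by
        refine mul_le_mul_of_nonneg_right ?_ (norm_nonneg _)
        simpa using V.le_of_opNorm_le hV x

/-- `|D|` is approximated in norm by `V D` with contractions `V`. -/
theorem exists_contraction_abs [CompleteSpace H] {D : H →L[ℂ] H} (hD : IsSelfAdjoint D) {ε : ℝ}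
    (hε : 0 < ε) : ∃ V : H →L[ℂ] H, ‖V‖ ≤ 1 ∧ ‖CFC.abs D - V * D‖ ≤ ε := by
  have hpos : ∀ x : ℝ, |x| + ε ≠ 0 := fun x => by positivity
  have hc : Continuous fun x : ℝ => x / (|x| + ε) :=
    continuous_id.div (continuous_abs.add continuous_const) hpos
  -- A continuous substitute for the sign function, so that the continuous functional calculus
  -- applies; its defect |x| - x²/(|x|+ε) = ε|x|/(|x|+ε) is at most ε.
  refine ⟨cfc (fun x : ℝ => x / (|x| + ε)) D, ?_, ?_⟩
  · refine norm_cfc_le zero_le_one fun x _ => ?_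
    rw [Real.norm_eq_abs, abs_div, abs_of_pos (by positivity : 0 < |x| + ε)]
    exact (div_le_one (by positivity)).2 (by linarith)
  · have h2 : cfc (fun x : ℝ => x / (|x| + ε)) D * D = cfc (fun x : ℝ => x / (|x| + ε) * x) D := by
      nth_rewrite 2 [← cfc_id ℝ D hD]
      rw [← cfc_mul _ _ D hc.continuousOn continuous_id.continuousOn]
      rfl
    rw [h2, CFC.abs_eq_cfc_norm D hD, ← cfc_sub (fun x : ℝ => ‖x‖)
      (fun x : ℝ => x / (|x| + ε) * x) D continuous_norm.continuousOn
      (hc.mul continuous_id).continuousOn]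
    refine norm_cfc_le hε.le fun x _ => ?_
    have h0 : 0 < |x| + ε := by positivity
    have h3 : ‖x‖ - x / (|x| + ε) * x = ε * (|x| / (|x| + ε)) := by
      rw [Real.norm_eq_abs]
      field_simp
      rw [← sq_abs x]
      ring
    rw [h3, Real.norm_of_nonneg (by positivity)]
    exact mul_le_of_le_one_right hε.le ((div_le_one h0).2 (by linarith))

/-- A sum in [0, ∞] is the supremum of its finite partial sums, so |D| need only be approximated by
V D with an error that is small on finitely many unit vectors. -/
theorem traceNorm_le_of_traceLE [CompleteSpace H] {D : H →L[ℂ] H} (hD : IsSelfAdjoint D) {c : ℝ}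
    (h : TraceLE D c) : traceNorm D ≤ ENNReal.ofReal c := by
  obtain ⟨B, hB⟩ := (exists_hilbertBasis ℂ H).choose_spec
  have hw : Orthonormal ℂ ((↑) : (exists_hilbertBasis ℂ H).choose → H) := by
    rw [← hB]; exact B.orthonormal
  have hpos : ∀ x : H, 0 ≤ RCLike.re (inner ℂ x (CFC.abs D x)) := fun x => by
    have := (ContinuousLinearMap.nonneg_iff_isPositive _).1 (CFC.abs_nonneg D)
    exact this.re_inner_nonneg_right x
  rw [traceNorm, ENNReal.tsum_eq_iSup_sum]
  refine iSup_le fun s => ?_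
  rw [← ENNReal.ofReal_sum_of_nonneg fun (e : (exists_hilbertBasis ℂ H).choose) _ => hpos e]
  refine ENNReal.ofReal_le_ofReal (le_of_forall_pos_le_add fun δ hδ => ?_)
  -- The total error over `s` stays below δ; the added 1 covers the empty partial sum.
  obtain ⟨V, hV, hVD⟩ := exists_contraction_abs hD
    (show 0 < δ / (s.card + 1) by positivity)
  have h1 : ∀ e ∈ s, RCLike.re (inner ℂ (e : H) (CFC.abs D (e : H))) ≤
      RCLike.re (inner ℂ (e : H) (V (D e))) + δ / (s.card + 1) := by
    intro e _
    have he : ‖(e : H)‖ = 1 := hw.1 e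
    have h2 : RCLike.re (inner ℂ (e : H) ((CFC.abs D - V * D) e)) ≤ δ / (s.card + 1) := by
      refine (RCLike.re_le_norm _).trans ((norm_inner_le_norm _ _).trans ?_)
      rw [he, one_mul]
      refine ((CFC.abs D - V * D).le_opNorm _).trans ?_
      rwa [he, mul_one]
    rw [sub_apply, inner_sub_right, map_sub] at h2
    have h3 : (V * D) (e : H) = V (D e) := rfl
    rw [h3] at h2
    linarith
  refine (Finset.sum_le_sum h1).trans ?_
  rw [Finset.sum_add_distrib, Finset.sum_const, nsmul_eq_mul]
  refine add_le_add (h V hV _ hw s) ?_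
  rw [mul_div_assoc', div_le_iff₀ (by positivity)]
  nlinarith

end TraceBound

/-! ### Strings of small weight -/

/-- Expansion of (p + (1-p))^n over bit strings: the total mass of n independent bits of bias p. -/
theorem sum_bernoulli_weight (n : ℕ) (p : ℝ) :
    ∑ x : BitStr n, p ^ hammingNorm x * (1 - p) ^ (n - hammingNorm x) = 1 := by
  have h : ∀ x : BitStr n, p ^ hammingNorm x * (1 - p) ^ (n - hammingNorm x) =
      ∏ i, if x i = 0 then 1 - p else p := by
    intro x
    have hc : (Finset.univ.filter fun i => x i = 0).card = n - hammingNorm x := by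
      have := Finset.card_filter_add_card_filter_not (s := (Finset.univ : Finset (Fin n)))
        fun i => x i = 0
      rw [Finset.card_univ, Fintype.card_fin] at this
      have h2 : hammingNorm x = (Finset.univ.filter fun i => ¬ x i = 0).card := rfl
      omega
    rw [Finset.prod_ite, Finset.prod_const, Finset.prod_const, hc, mul_comm]
    rfl
  simp only [h]
  rw [← Fintype.piFinset_univ, ← Finset.prod_univ_sum (fun _ => Finset.univ)
    (fun _ (a : ZMod 2) => if a = 0 then 1 - p else p)]
  have hu : (Finset.univ : Finset (ZMod 2)) = {0, 1} := by decide
  simp [hu]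

theorem two_rpow_neg_entropy {n t : ℕ} (ht : 0 < t) (htn : t < n) :
    (2 : ℝ) ^ (-((n : ℝ) * H₂ ((t : ℝ) / n))) =
      ((t : ℝ) / n) ^ t * (1 - (t : ℝ) / n) ^ (n - t) := by
  have hn : (0 : ℝ) < n := by exact_mod_cast ht.trans htn
  have hp : (0 : ℝ) < (t : ℝ) / n := div_pos (by exact_mod_cast ht) hn
  have hq : (0 : ℝ) < 1 - (t : ℝ) / n := by
    rw [sub_pos, div_lt_one hn]; exact_mod_cast htn
  have e1 : (((t : ℝ) / n) ^ t : ℝ) = 2 ^ (Real.logb 2 ((t : ℝ) / n) * t) := by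
    rw [Real.rpow_mul (by norm_num), Real.rpow_logb (by norm_num) (by norm_num) hp,
      Real.rpow_natCast]
  have e2 : ((1 - (t : ℝ) / n) ^ (n - t) : ℝ) =
      2 ^ (Real.logb 2 (1 - (t : ℝ) / n) * ((n : ℝ) - t)) := by
    rw [Real.rpow_mul (by norm_num), Real.rpow_logb (by norm_num) (by norm_num) hq,
      ← Nat.cast_sub htn.le, Real.rpow_natCast]
  rw [e1, e2, ← Real.rpow_add (by norm_num), H₂]
  congr 1
  field_simp
  ring

/-- Take independent bits of bias p = t/n ≤ 1/2. Each string lighter than t has mass at least p^t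
(1-p)^(n-t) = 2^{-n H₂(p)}, and the total mass is 1. -/
theorem card_weight_lt_le {n t : ℕ} (ht : (t : ℝ) ≤ (n : ℝ) / 2) :
    ((Finset.univ.filter fun x : BitStr n => hammingNorm x < t).card : ℝ) ≤
      (2 : ℝ) ^ ((n : ℝ) * H₂ ((t : ℝ) / n)) := by
  rcases Nat.eq_zero_or_pos t with rfl | h0
  · simp only [Nat.not_lt_zero, Finset.filter_false, Finset.card_empty, Nat.cast_zero]
    positivity
  have h0' : (0 : ℝ) < t := by exact_mod_cast h0
  have hn : (0 : ℝ) < n := by linarith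
  have htn : t < n := by
    have : (t : ℝ) < n := by linarith
    exact_mod_cast this
  set p : ℝ := (t : ℝ) / n with hp
  have hp0 : 0 < p := div_pos h0' hn
  have hp2 : p ≤ 1 - p := by
    have : p ≤ 1 / 2 := by rw [hp, div_le_iff₀ hn]; linarith
    linarith
  have hq0 : 0 < 1 - p := hp0.trans_le hp2
  have key : ((Finset.univ.filter fun x : BitStr n => hammingNorm x < t).card : ℝ) *
      (p ^ t * (1 - p) ^ (n - t)) ≤ 1 := by
    refine le_trans ?_ (sum_bernoulli_weight n p).le
    rw [← nsmul_eq_mul, ← Finset.sum_const]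
    refine (Finset.sum_le_sum fun x hx => ?_).trans
      (Finset.sum_le_sum_of_subset_of_nonneg (Finset.filter_subset _ _) fun x _ _ =>
        mul_nonneg (pow_nonneg hp0.le _) (pow_nonneg hq0.le _))
    rw [Finset.mem_filter] at hx
    -- Here d = t - |x|: trading d factors p for d factors 1-p ≥ p can only increase the mass.
    obtain ⟨d, hd⟩ := Nat.exists_eq_add_of_le hx.2.le
    have e : n - hammingNorm x = (n - t) + d := by omega
    rw [hd, e, pow_add, pow_add, ← hd, mul_assoc]
    refine mul_le_mul_of_nonneg_left ?_ (by positivity)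
    rw [mul_comm]
    exact mul_le_mul_of_nonneg_left (pow_le_pow_left₀ hp0.le hp2 d)
      (pow_nonneg hq0.le _)
  rw [hp, ← two_rpow_neg_entropy h0 htn, Real.rpow_neg (by norm_num), ← div_eq_mul_inv,
    div_le_one (by positivity)] at key
  exact key

/-! ### Uniformly random valid matrices -/

/-- A transvection x ↦ x + f(x)(w - v) with f(v) = f(w) = 1 works. It is an involution because f(w -
v) = 0 and the characteristic is 2. -/
theorem exists_linearEquiv_bits {n : ℕ} {v w : BitStr n} (hv : v ≠ 0) (hw : w ≠ 0) :
    ∃ e : BitStr n ≃ₗ[ZMod 2] BitStr n, e v = w := by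
  have hne : ∀ x : BitStr n, x ≠ 0 → ∃ i, x i = 1 := fun x hx => by
    by_contra! h
    exact hx (funext fun i => (bit_cases (x i)).resolve_right (h i))
  obtain ⟨f, hfv, hfw⟩ : ∃ f : BitStr n →ₗ[ZMod 2] ZMod 2, f v = 1 ∧ f w = 1 := by
    obtain ⟨i, hi⟩ := hne v hv
    obtain ⟨j, hj⟩ := hne w hw
    rcases bit_cases (w i) with h | h
    · rcases bit_cases (v j) with h' | h'
      · refine ⟨LinearMap.proj (R := ZMod 2) (φ := fun _ => ZMod 2) i +
          LinearMap.proj (R := ZMod 2) (φ := fun _ => ZMod 2) j, ?_, ?_⟩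
        · simp [hi, h']
        · simp [hj, h]
      · exact ⟨LinearMap.proj (R := ZMod 2) (φ := fun _ => ZMod 2) j, h', hj⟩
    · exact ⟨LinearMap.proj (R := ZMod 2) (φ := fun _ => ZMod 2) i, hi, h⟩
  refine ⟨LinearEquiv.ofInvolutive (LinearMap.id + f.smulRight (w - v)) fun x => ?_, ?_⟩
  · have h2 : f x • (w - v) + f x • (w - v) = 0 := 
      funext fun i => CharTwo.add_self_eq_zero ((f x • (w - v)) i)
    simp [hfv, hfw, add_assoc, h2]
  · change v + f v • (w - v) = w
    rw [hfv, one_smul, add_sub_cancel]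

namespace KeyMat

variable {n r m : ℕ}

/-- The combination `x P_C + y P_K` of the rows of the two matrices. -/
def comb (P : KeyMat n r m) : (Fin r ⊕ Fin m → ZMod 2) →ₗ[ZMod 2] BitStr n :=
  (Matrix.fromRows P.1 P.2).vecMulLinear

theorem comb_apply (P : KeyMat n r m) (u : Fin r ⊕ Fin m → ZMod 2) :
    P.comb u = u ᵥ* Matrix.fromRows P.1 P.2 := rfl

theorem Valid.comb_injective {P : KeyMat n r m} (h : P.Valid) : Function.Injective P.comb :=
  Matrix.vecMul_injective_iff.2 h

/-- Invertible column operations on both matrices. -/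
def mapRows (e : BitStr n ≃ₗ[ZMod 2] BitStr n) : KeyMat n r m ≃ KeyMat n r m :=
  Equiv.prodCongr (Equiv.piCongrRight fun _ => e.toEquiv) (Equiv.piCongrRight fun _ => e.toEquiv)

theorem fromRows_mapRows (e : BitStr n ≃ₗ[ZMod 2] BitStr n) (P : KeyMat n r m) :
    (Matrix.fromRows (mapRows e P).1 (mapRows e P).2).row =
      e ∘ (Matrix.fromRows P.1 P.2).row := by
  funext i
  rcases i with i | i <;> rfl

theorem valid_mapRows (e : BitStr n ≃ₗ[ZMod 2] BitStr n) (P : KeyMat n r m) :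
    (mapRows e P).Valid ↔ P.Valid := by
  rw [Valid, fromRows_mapRows]
  exact LinearMap.linearIndependent_iff e.toLinearMap e.ker

theorem comb_mapRows (e : BitStr n ≃ₗ[ZMod 2] BitStr n) (P : KeyMat n r m)
    (u : Fin r ⊕ Fin m → ZMod 2) : (mapRows e P).comb u = e (P.comb u) := by
  rw [comb_apply, comb_apply, Matrix.vecMul_eq_sum, Matrix.vecMul_eq_sum, map_sum]
  refine Finset.sum_congr rfl fun i _ => ?_
  rw [map_smul]
  exact congrArg _ (congrFun (fromRows_mapRows e P) i)

end KeyMat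

theorem matProb_nonneg {n r m : ℕ} (P : KeyMat n r m) : 0 ≤ matProb P := by
  unfold matProb
  split_ifs <;> positivity

theorem matProb_of_not_valid {n r m : ℕ} {P : KeyMat n r m} (h : ¬ P.Valid) : matProb P = 0 :=
  if_neg h

theorem matProb_mapRows {n r m : ℕ} (e : BitStr n ≃ₗ[ZMod 2] BitStr n) (P : KeyMat n r m) :
    matProb (KeyMat.mapRows e P) = matProb P := by
  unfold matProb
  by_cases h : P.Valid
  · rw [if_pos h, if_pos ((KeyMat.valid_mapRows e P).2 h)]
  · rw [if_neg h, if_neg fun h' => h ((KeyMat.valid_mapRows e P).1 h')]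

theorem exists_valid {n r m : ℕ} (h : r + m ≤ n) : ∃ P : KeyMat n r m, P.Valid := by
  have e : Fin r ⊕ Fin m ↪ Fin n :=
    (finSumFinEquiv.toEmbedding).trans (Fin.castLEEmb h)
  refine ⟨(fun i => Pi.single (e (Sum.inl i)) 1, fun i => Pi.single (e (Sum.inr i)) 1), ?_⟩
  have h1 := (Pi.basisFun (ZMod 2) (Fin n)).linearIndependent.comp e e.injective
  rw [KeyMat.Valid]
  convert h1 using 1
  funext i
  rcases i with i | i <;> simp [Matrix.row] <;> rfl

theorem sum_matProb {n r m : ℕ} (h : r + m ≤ n) : ∑ P : KeyMat n r m, matProb P = 1 := by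
  classical
  obtain ⟨P, hP⟩ := exists_valid h
  have hc : ((Finset.univ.filter fun P' : KeyMat n r m => P'.Valid).card : ℝ) ≠ 0 := by
    rw [Nat.cast_ne_zero, Finset.card_ne_zero]
    exact ⟨P, by simp [hP]⟩
  unfold matProb
  rw [← Finset.sum_filter, Finset.sum_const, nsmul_eq_mul, mul_one_div]
  convert div_self hc

-- Invertible column operations preserve the law of the matrices and act transitively on nonzero
-- vectors. Hence the combination with coefficients u hits each of the 2^n - 1 nonzero vectors with
-- the same probability, and these events are disjoint.
open Classical in
theorem sum_matProb_comb_eq_le {n r m : ℕ} (hrm : r + m ≤ n) (u : Fin r ⊕ Fin m → ZMod 2)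
    {v : BitStr n} (hv : v ≠ 0) :
    ((2 : ℝ) ^ n - 1) * (∑ P : KeyMat n r m, matProb P * if P.comb u = v then 1 else 0) ≤ 1 := by
  have hsame : ∀ w : BitStr n, w ≠ 0 →
      (∑ P : KeyMat n r m, matProb P * if P.comb u = w then (1 : ℝ) else 0) =
        ∑ P : KeyMat n r m, matProb P * if P.comb u = v then 1 else 0 := by
    intro w hw
    obtain ⟨e, he⟩ := exists_linearEquiv_bits hv hw
    rw [← (KeyMat.mapRows e).sum_comp]
    refine Finset.sum_congr rfl fun P _ => ?_
    simp only [matProb_mapRows, KeyMat.comb_mapRows, ← he, e.injective.eq_iff]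
  have hcard : (((Finset.univ : Finset (BitStr n)).erase 0).card : ℝ) = 2 ^ n - 1 := by
    rw [Finset.card_erase_of_mem (Finset.mem_univ _), Finset.card_univ, Fintype.card_fun,
      ZMod.card, Fintype.card_fin, Nat.cast_sub Nat.one_le_two_pow]
    simp
  rw [← hcard, ← nsmul_eq_mul, ← Finset.sum_const,
    ← Finset.sum_congr rfl fun w hw => hsame w (Finset.ne_of_mem_erase hw), Finset.sum_comm]
  refine le_trans ?_ (sum_matProb hrm).le
  refine Finset.sum_le_sum fun P _ => ?_
  rw [← Finset.mul_sum]
  refine mul_le_of_le_one_right (matProb_nonneg P) ?_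
  rw [Finset.sum_ite_eq]
  split_ifs <;> norm_num

/-- Half of the strings are orthogonal to a given nonzero string. -/
theorem two_mul_card_dotProduct_eq_one_le {ι : Type*} [Fintype ι] [DecidableEq ι]
    (a : ι → ZMod 2) :
    2 * (Finset.univ.filter fun u : ι → ZMod 2 => u ⬝ᵥ a = 1).card ≤ 2 ^ Fintype.card ι := by
  rcases (Finset.univ.filter fun u : ι → ZMod 2 => u ⬝ᵥ a = 1).eq_empty_or_nonempty with h | h
  · simp [h]
  obtain ⟨u₀, hu₀⟩ := h
  rw [Finset.mem_filter] at hu₀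
  -- Translation by one solution u₀ injects the solutions of u·a = 1 into the complement.
  have h1 : (Finset.univ.filter fun u : ι → ZMod 2 => u ⬝ᵥ a = 1).card ≤
      (Finset.univ.filter fun u : ι → ZMod 2 => ¬ u ⬝ᵥ a = 1).card := by
    refine Finset.card_le_card_of_injOn (fun u => u + u₀) (fun u hu => ?_)
      (fun u _ u' _ h => add_right_cancel h)
    simp only [Finset.coe_filter, Finset.mem_univ, true_and, Set.mem_ofPred_eq] at hu ⊢
    rw [add_dotProduct, hu, hu₀.2, bit_one_add_one]
    decide
  have h2 := Finset.card_filter_add_card_filter_not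
    (s := (Finset.univ : Finset (ι → ZMod 2))) fun u => u ⬝ᵥ a = 1
  rw [Finset.card_univ, Fintype.card_fun, ZMod.card] at h2
  omega

-- Union bound over u. At most 2^{r+m-1} coefficient vectors satisfy u·a = 1, and each contributes
-- at most 1/(2^n - 1) ≤ 2/2^n. The restriction to half of the coefficients exactly absorbs the
-- factor 2.
open Classical in
theorem sum_matProb_exists_comb_le {n r m : ℕ} (hrm : r + m ≤ n) (hn : n ≠ 0)
    (a : Fin r ⊕ Fin m → ZMod 2) {v : BitStr n} (hv : v ≠ 0) :
    ∑ P : KeyMat n r m, matProb P * (if ∃ u, u ⬝ᵥ a = 1 ∧ P.comb u = v then 1 else 0) ≤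
      (2 : ℝ) ^ (r + m) / 2 ^ n := by
  set S := Finset.univ.filter fun u : Fin r ⊕ Fin m → ZMod 2 => u ⬝ᵥ a = 1 with hS
  have h1 : (∑ P : KeyMat n r m,
      matProb P * (if ∃ u, u ⬝ᵥ a = 1 ∧ P.comb u = v then (1 : ℝ) else 0)) ≤
      ∑ u ∈ S, ∑ P : KeyMat n r m, matProb P * if P.comb u = v then 1 else 0 := by
    rw [Finset.sum_comm]
    refine Finset.sum_le_sum fun P _ => ?_
    rw [← Finset.mul_sum]
    refine mul_le_mul_of_nonneg_left ?_ (matProb_nonneg P)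
    split_ifs with h
    · obtain ⟨u, hu, hu'⟩ := h
      refine le_trans ?_ (Finset.single_le_sum (a := u) (fun w _ => ?_) (by simp [hS, hu]))
      · simp [hu']
      · split_ifs <;> norm_num
    · exact Finset.sum_nonneg fun w _ => by split_ifs <;> norm_num
  have hpow : (2 : ℝ) ≤ 2 ^ n := by
    calc (2 : ℝ) = 2 ^ 1 := by norm_num
      _ ≤ 2 ^ n := pow_le_pow_right₀ (by norm_num) (Nat.one_le_iff_ne_zero.2 hn)
  have h2 : ∀ u ∈ S, (∑ P : KeyMat n r m, matProb P * if P.comb u = v then (1 : ℝ) else 0) ≤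
      2 / 2 ^ n := by
    intro u _
    have h3 := sum_matProb_comb_eq_le hrm u hv
    have h0 : 0 ≤ ∑ P : KeyMat n r m, matProb P * if P.comb u = v then (1 : ℝ) else 0 :=
      Finset.sum_nonneg fun P _ => mul_nonneg (matProb_nonneg P) (by split_ifs <;> norm_num)
    rw [le_div_iff₀ (by positivity)]
    nlinarith
  have h4 := Finset.sum_le_sum h2
  rw [Finset.sum_const, nsmul_eq_mul] at h4
  refine h1.trans (h4.trans ?_)
  have h5 := two_mul_card_dotProduct_eq_one_le a
  rw [Fintype.card_sum, Fintype.card_fin, Fintype.card_fin] at h5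
  have h6 : (2 : ℝ) * S.card ≤ 2 ^ (r + m) := by exact_mod_cast h5
  rw [mul_div_assoc']
  gcongr
  linarith

/-! ### Fourier analysis on bit strings -/

section Fourier

theorem sgn_mul_self (a : ZMod 2) : sgn a * sgn a = 1 := by
  unfold sgn; split_ifs <;> norm_num

theorem conj_sgn (a : ZMod 2) : (starRingEnd ℂ) (sgn a) = sgn a := by
  unfold sgn; split_ifs <;> simp

theorem norm_sgn (a : ZMod 2) : ‖sgn a‖ = 1 := by
  unfold sgn; split_ifs <;> simp

theorem add_self_bits {ι : Type*} (x : ι → ZMod 2) : x + x = 0 :=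
  funext fun _ => CharTwo.add_self_eq_zero _

theorem add_eq_zero_iff_bits {ι : Type*} {x y : ι → ZMod 2} : x + y = 0 ↔ x = y := by
  constructor
  · intro h
    have := congrArg (· + y) h
    simpa [add_assoc, add_self_bits] using this
  · rintro rfl
    exact add_self_bits x

variable {ι : Type*} [Fintype ι] [DecidableEq ι]

theorem sum_sgn_dotProduct (l : ι → ZMod 2) :
    ∑ i : ι → ZMod 2, sgn (i ⬝ᵥ l) = if l = 0 then 2 ^ Fintype.card ι else 0 := by
  simp only [dotProduct, sgn_sum]
  rw [← Fintype.piFinset_univ, ← Finset.prod_univ_sum (fun _ => Finset.univ)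
    (fun p (a : ZMod 2) => sgn (a * l p))]
  have h1 : ∀ c : ZMod 2, ∑ a : ZMod 2, sgn (a * c) = if c = 0 then 2 else 0 := by
    have hu : (Finset.univ : Finset (ZMod 2)) = {0, 1} := by decide
    intro c
    rw [hu, Finset.sum_pair (by decide)]
    rcases bit_cases c with rfl | rfl <;> norm_num [sgn]
  simp only [h1, Finset.prod_ite_zero, Finset.mem_univ, true_imp_iff, funext_iff,
    Finset.prod_const, Finset.card_univ, Pi.zero_apply]

theorem sum_sgn_mul_sgn (l l' : ι → ZMod 2) :
    ∑ i : ι → ZMod 2, sgn (i ⬝ᵥ l) * sgn (i ⬝ᵥ l') =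
      if l = l' then 2 ^ Fintype.card ι else 0 := by
  simp only [← sgn_add, ← dotProduct_add, sum_sgn_dotProduct, add_eq_zero_iff_bits]

theorem sum_sgn_mul_sgn' (l l' : ι → ZMod 2) :
    ∑ i : ι → ZMod 2, sgn (l ⬝ᵥ i) * sgn (l' ⬝ᵥ i) =
      if l = l' then 2 ^ Fintype.card ι else 0 := by
  simp only [dotProduct_comm l, dotProduct_comm l', sum_sgn_mul_sgn]

variable {V : Type*} [NormedAddCommGroup V] [InnerProductSpace ℂ V]

theorem fourier_inversion (f : (ι → ZMod 2) → V) (i : ι → ZMod 2) :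
    ∑ l : ι → ZMod 2, sgn (i ⬝ᵥ l) • ∑ j, sgn (j ⬝ᵥ l) • f j =
      (2 : ℂ) ^ Fintype.card ι • f i := by
  simp only [Finset.smul_sum, smul_smul]
  rw [Finset.sum_comm]
  simp only [← Finset.sum_smul, sum_sgn_mul_sgn', ite_smul, zero_smul]
  simp

theorem parseval_rankOne (f g : (ι → ZMod 2) → V) :
    ∑ l : ι → ZMod 2, InnerProductSpace.rankOne ℂ (∑ i, sgn (i ⬝ᵥ l) • f i)
        (∑ j, sgn (j ⬝ᵥ l) • g j) =
      (2 : ℂ) ^ Fintype.card ι • ∑ i, InnerProductSpace.rankOne ℂ (f i) (g i) := by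
  simp only [map_sum, sum_apply, map_smulₛₗ, RingHom.id_apply, conj_sgn, smul_apply,
    Finset.smul_sum, smul_smul]
  rw [Finset.sum_comm]
  refine Finset.sum_congr rfl fun i _ => ?_
  rw [Finset.sum_comm]
  simp only [← Finset.sum_smul, sum_sgn_mul_sgn', ite_smul, zero_smul]
  simp

theorem parseval_inner (f g : (ι → ZMod 2) → V) :
    ∑ l : ι → ZMod 2, inner ℂ (∑ i, sgn (i ⬝ᵥ l) • f i) (∑ j, sgn (j ⬝ᵥ l) • g j) =
      (2 : ℂ) ^ Fintype.card ι * ∑ i, inner ℂ (f i) (g i) := by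
  simp only [sum_inner, inner_sum, inner_smul_left, inner_smul_right, conj_sgn, Finset.mul_sum,
    ← mul_assoc]
  rw [Finset.sum_comm]
  refine Finset.sum_congr rfl fun i _ => ?_
  rw [Finset.sum_comm]
  simp only [← Finset.sum_mul, sum_sgn_mul_sgn', ite_mul, zero_mul]
  simp

theorem parseval_norm (f : (ι → ZMod 2) → V) :
    ∑ l : ι → ZMod 2, ‖∑ i, sgn (i ⬝ᵥ l) • f i‖ ^ 2 =
      (2 : ℝ) ^ Fintype.card ι * ∑ i, ‖f i‖ ^ 2 := by
  have h := parseval_inner f f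
  simp only [inner_self_eq_norm_sq_to_K, Complex.coe_algebraMap] at h
  exact_mod_cast h

end Fourier

/-! ### Splitting a string into its INFO part and its TEST part -/

section Split

variable {N n : ℕ} (s : Sel N n)

theorem infoPart_join (u : BitStr n) (v : BitStr (N - n)) : infoPart s (join s u v) = u := by
  funext p; simp [infoPart, join]

theorem testPart_join (u : BitStr n) (v : BitStr (N - n)) : testPart s (join s u v) = v := by
  funext p; simp [testPart, join]

theorem join_infoPart_testPart (x : BitStr N) : join s (infoPart s x) (testPart s x) = x := by
  funext p
  obtain ⟨q, rfl⟩ := (splitPos s).surjective p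
  rcases q with q | q <;> simp [join, infoPart, testPart]

theorem join_add (u u' : BitStr n) (v v' : BitStr (N - n)) :
    join s u v + join s u' v' = join s (u + u') (v + v') := by
  funext p
  obtain ⟨q, rfl⟩ := (splitPos s).surjective p
  rcases q with q | q <;> simp [join]

theorem join_dotProduct_join (u u' : BitStr n) (v v' : BitStr (N - n)) :
    join s u v ⬝ᵥ join s u' v' = u ⬝ᵥ u' + v ⬝ᵥ v' := by
  rw [dotProduct, ← (splitPos s).sum_comp, Fintype.sum_sum_type]
  simp [join, dotProduct]

/-- Strings as pairs of an INFO part and a TEST part. -/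
def joinEquiv : BitStr n × BitStr (N - n) ≃ BitStr N where
  toFun x := join s x.1 x.2
  invFun x := (infoPart s x, testPart s x)
  left_inv x := Prod.ext (infoPart_join s x.1 x.2) (testPart_join s x.1 x.2)
  right_inv x := join_infoPart_testPart s x

theorem sum_join {M : Type*} [AddCommMonoid M] (f : BitStr N → M) :
    ∑ x, f x = ∑ u, ∑ v, f (join s u v) := by
  rw [← (joinEquiv s).sum_comp, Fintype.sum_prod_type]
  rfl

theorem sel_splitPos_inl (p : Fin n) : s.1 (splitPos s (Sum.inl p)) = 1 := by
  have h : splitPos s (Sum.inl p) ∈ infoSet s := by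
    rw [splitPos, finSumEquivOfFinset_inl]
    exact Finset.orderEmbOfFin_mem _ _ _
  exact (bit_cases _).resolve_left (Finset.mem_filter.1 h).2

theorem sel_splitPos_inr (p : Fin (N - n)) : s.1 (splitPos s (Sum.inr p)) = 0 := by
  have h : splitPos s (Sum.inr p) ∈ (infoSet s)ᶜ := by
    rw [splitPos, finSumEquivOfFinset_inr]
    exact Finset.orderEmbOfFin_mem _ _ _
  rw [Finset.mem_compl] at h
  by_contra h'
  exact h (Finset.mem_filter.2 ⟨Finset.mem_univ _, h'⟩)

end Split

/-! ### The inverted basis -/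

theorem qubitAmp_add_one (b i q : ZMod 2) :
    qubitAmp (b + 1) i q = (1 / Real.sqrt 2 : ℝ) * ∑ a, sgn (i * a) * qubitAmp b a q := by
  have h2 : ((Real.sqrt 2 : ℝ) : ℂ)⁻¹ * ((Real.sqrt 2 : ℝ) : ℂ)⁻¹ = 1 / 2 := by
    rw [← mul_inv, ← Complex.ofReal_mul, Real.mul_self_sqrt (by norm_num)]; norm_num
  have hu : (Finset.univ : Finset (ZMod 2)) = {0, 1} := by decide
  rw [hu, Finset.sum_pair (by decide)]
  rcases bit_cases b with rfl | rfl <;> rcases bit_cases i with rfl | rfl <;>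
    rcases bit_cases q with rfl | rfl <;>
    simp [sgn, qubitAmp, bit_one_add_one, div_eq_mul_inv, mul_add, h2] <;> norm_num

theorem ketAmp_eq_mul {N n : ℕ} (s : Sel N n) (b i q : BitStr N) :
    ketAmp b i q =
      (∏ p, qubitAmp (infoPart s b p) (infoPart s i p) (infoPart s q p)) *
        ∏ p, qubitAmp (testPart s b p) (testPart s i p) (testPart s q p) := by
  rw [ketAmp, ← (splitPos s).prod_comp, Fintype.prod_sum_type]
  rfl

/-- Adding s to the basis string toggles the basis at the INFO positions and nowhere else, so it
acts as a Hadamard transform in the INFO bits alone. -/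
theorem ketAmp_add_sel {N n : ℕ} (s : Sel N n) (b q : BitStr N) (u : BitStr n)
    (v : BitStr (N - n)) :
    ketAmp (b + s.1) (join s u v) q =
      (((1 / Real.sqrt 2) ^ n : ℝ) : ℂ) * ∑ u', sgn (u ⬝ᵥ u') * ketAmp b (join s u' v) q := by
  have h1 : infoPart s (b + s.1) = infoPart s b + 1 :=
    funext fun p => congrArg (b _ + ·) (sel_splitPos_inl s p)
  have h2 : testPart s (b + s.1) = testPart s b :=
    funext fun p => (congrArg (b _ + ·) (sel_splitPos_inr s p)).trans (add_zero _)
  simp only [ketAmp_eq_mul s, infoPart_join, testPart_join, h1, h2, Pi.add_apply, Pi.one_apply,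
    qubitAmp_add_one, Finset.prod_mul_distrib, Finset.prod_const, Finset.card_univ,
    Fintype.card_fin, dotProduct, sgn_sum]
  rw [Finset.prod_univ_sum, Fintype.piFinset_univ]
  simp only [Finset.prod_mul_distrib, ← mul_assoc, ← Finset.sum_mul]
  push_cast
  ring

section Attacks

variable {N n : ℕ} {E : Type*} [NormedAddCommGroup E] [InnerProductSpace ℂ E]

theorem withKet_add_sel (s : Sel N n) (e : E) (b : BitStr N) (u : BitStr n) (v : BitStr (N - n)) :
    withKet e (b + s.1) (join s u v) =
      (((1 / Real.sqrt 2) ^ n : ℝ) : ℂ) • ∑ u', sgn (u ⬝ᵥ u') • withKet e b (join s u' v) := by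
  ext q
  simp only [withKet, ketAmp_add_sel, PiLp.smul_apply, WithLp.ofLp_sum, Finset.sum_apply,
    smul_smul, Finset.smul_sum, Finset.mul_sum, Finset.sum_smul, mul_assoc]

theorem bra_add_sel (s : Sel N n) (f : Reg (BitStr N) E) (b : BitStr N) (u : BitStr n)
    (v : BitStr (N - n)) :
    bra (b + s.1) (join s u v) f =
      (((1 / Real.sqrt 2) ^ n : ℝ) : ℂ) • ∑ u', sgn (u ⬝ᵥ u') • bra b (join s u' v) f := by
  simp only [bra, ketAmp_add_sel, map_mul, map_sum, conj_sgn, Complex.conj_ofReal,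
    Finset.smul_sum, Finset.mul_sum, Finset.sum_smul, smul_smul]
  rw [Finset.sum_comm]

theorem bra_sum {ι : Type*} (t : Finset ι) (b j : BitStr N) (f : ι → Reg (BitStr N) E) :
    bra b j (∑ i ∈ t, f i) = ∑ i ∈ t, bra b j (f i) := by
  simp only [bra, WithLp.ofLp_sum, Finset.sum_apply, Finset.smul_sum]
  exact Finset.sum_comm

theorem bra_smul (b j : BitStr N) (c : ℂ) (f : Reg (BitStr N) E) :
    bra b j (c • f) = c • bra b j f := by
  simp only [bra, PiLp.smul_apply, Finset.smul_sum, smul_comm c]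

theorem Attack.eve_add_sel (A : Attack N E) (s : Sel N n) (b : BitStr N) (u u₂ : BitStr n)
    (v v₂ : BitStr (N - n)) :
    A.eve (b + s.1) (join s u v) (join s u₂ v₂) =
      (1 / 2 ^ n : ℂ) • ∑ u', ∑ u₂', (sgn (u ⬝ᵥ u') * sgn (u₂ ⬝ᵥ u₂')) •
        A.eve b (join s u' v) (join s u₂' v₂) := by
  have h2 : (((1 / Real.sqrt 2) ^ n : ℝ) : ℂ) * (((1 / Real.sqrt 2) ^ n : ℝ) : ℂ) = 1 / 2 ^ n := by
    rw [← Complex.ofReal_mul, ← mul_pow, div_mul_div_comm, Real.mul_self_sqrt (by norm_num)]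
    simp
  rw [Attack.eve, withKet_add_sel, map_smul, map_sum, bra_smul, bra_sum]
  simp only [map_smul, bra_smul, bra_add_sel, ← h2, Finset.smul_sum, smul_smul, Attack.eve]
  refine Finset.sum_congr rfl fun _ _ => Finset.sum_congr rfl fun _ _ => ?_
  congr 1
  ring

/-- The Fourier transform over the INFO bits of the probe states with a given error string. -/
def Attack.eveFourier (A : Attack N E) (b : BitStr N) (s : Sel N n) (cT v : BitStr (N - n))
    (l c : BitStr n) : E :=
  ∑ u, sgn (u ⬝ᵥ l) • A.eve b (join s u v) (join s (u + c) (v + cT))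

/-- The probability of the error string `l` on the INFO bits and `cT` on the TEST bits when the
INFO bits are sent and measured in the inverted basis; see `Attack.sum_eve_add_sel`. -/
def Attack.invErr (A : Attack N E) (b : BitStr N) (s : Sel N n) (cT : BitStr (N - n))
    (l : BitStr n) : ℝ :=
  1 / 2 ^ N * (1 / 2 ^ n) * ∑ v, ∑ c, ‖A.eveFourier b s cT v l c‖ ^ 2

theorem Attack.invErr_nonneg (A : Attack N E) (b : BitStr N) (s : Sel N n) (cT : BitStr (N - n))
    (l : BitStr n) : 0 ≤ A.invErr b s cT l := by
  unfold Attack.invErr; positivity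

/-- With the inner sum reindexed by the INFO error c, the exponent u·u' + (u+l)·(u'+c) loses its two
terms u·u'. What remains is one Fourier transform from c to u, ready for Parseval. -/
theorem Attack.eve_add_sel_error (A : Attack N E) (b : BitStr N) (s : Sel N n)
    (cT v : BitStr (N - n)) (l u : BitStr n) :
    A.eve (b + s.1) (join s u v) (join s (u + l) (v + cT)) =
      (1 / 2 ^ n : ℂ) • ∑ c, sgn (c ⬝ᵥ u) • sgn (l ⬝ᵥ c) • A.eveFourier b s cT v l c := by
  rw [A.eve_add_sel]
  congr 1
  simp only [Attack.eveFourier, Finset.smul_sum, smul_smul]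
  conv_rhs => rw [Finset.sum_comm]
  refine Finset.sum_congr rfl fun u' _ => ?_
  rw [← Equiv.sum_comp (Equiv.addLeft u')]
  refine Finset.sum_congr rfl fun c _ => ?_
  rw [Equiv.coe_addLeft]
  congr 1
  simp only [← sgn_add]
  congr 1
  rw [add_dotProduct, dotProduct_add, dotProduct_add, dotProduct_comm c u, dotProduct_comm u' l]
  have := CharTwo.add_self_eq_zero (u ⬝ᵥ u')
  linear_combination this

theorem Attack.sum_eve_add_sel (A : Attack N E) (b : BitStr N) (s : Sel N n)
    (cT : BitStr (N - n)) (l : BitStr n) :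
    1 / 2 ^ N * ∑ v, ∑ u, ‖A.eve (b + s.1) (join s u v) (join s (u + l) (v + cT))‖ ^ 2 =
      A.invErr b s cT l := by
  have h2 : ‖(1 / 2 ^ n : ℂ)‖ = 1 / 2 ^ n := by simp
  simp only [A.eve_add_sel_error, norm_smul, mul_pow, ← Finset.mul_sum, h2]
  have h := fun v => parseval_norm fun c => sgn (l ⬝ᵥ c) • A.eveFourier b s cT v l c
  simp only [Fintype.card_fin, norm_smul, norm_sgn, one_mul] at h
  simp only [h, ← Finset.mul_sum, Attack.invErr]
  field_simp

/-! ### The symmetrized attack -/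

theorem symS_symm_coord (g : Reg (BitStr N) (Reg (BitStr N) E)) (q m : BitStr N) :
    (symS E N).symm g q m = sgn (q ⬝ᵥ m) • g (q + m) m := by
  obtain ⟨f, rfl⟩ := (symS E N).surjective g
  rw [LinearIsometryEquiv.symm_apply_apply, symS_coord, add_assoc, add_self_bits, add_zero,
    smul_smul, sgn_mul_self, one_smul]

theorem bra_coord (b j m : BitStr N) (f : Reg (BitStr N) (Reg (BitStr N) E)) :
    bra b j f m = bra b j (WithLp.toLp 2 fun q => f q m) := by
  simp [bra]

/-- S contributes the sign of (i+b)·m and S† that of (j+b)·m; the basis string cancels in the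
product. The mask thus shifts both strings and records a character of the error string. -/
theorem Attack.eve_symmetrize (A : Attack N E) (b i j m : BitStr N) :
    A.symmetrize.eve b i j m =
      (((1 / Real.sqrt (2 ^ N) : ℝ) : ℂ) * sgn ((i + j) ⬝ᵥ m)) • A.eve b (i + m) (j + m) := by
  have h1 : (WithLp.toLp 2 fun q => symS E N (withKet (withPlus N A.probe) b i) q m) =
      (((1 / Real.sqrt (2 ^ N) : ℝ) : ℂ) * sgn ((i + b) ⬝ᵥ m)) • withKet A.probe b (i + m) := by
    ext q
    simp only [symS_coord, withKet, withPlus, PiLp.smul_apply, smul_smul]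
    congr 1
    have := ketAmp_twist b i q m
    linear_combination ((1 / Real.sqrt (2 ^ N) : ℝ) : ℂ) * this
  have h2 : ∀ G : Reg (BitStr N) E,
      bra b j (WithLp.toLp 2 fun q => sgn (q ⬝ᵥ m) • G (q + m)) =
        sgn ((j + b) ⬝ᵥ m) • bra b (j + m) G := by
    intro G
    simp only [bra]
    rw [← Equiv.sum_comp (Equiv.addRight m), Finset.smul_sum]
    refine Finset.sum_congr rfl fun q _ => ?_
    have h := congrArg (starRingEnd ℂ) (ketAmp_twist b j q m)
    simp only [map_mul, conj_sgn] at h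
    simp only [Equiv.coe_addRight, add_assoc, add_self_bits, add_zero, smul_smul]
    rw [← h, mul_comm]
  have h3 : sgn ((i + b) ⬝ᵥ m) * sgn ((j + b) ⬝ᵥ m) = sgn ((i + j) ⬝ᵥ m) := by
    have hb : i + b + (j + b) = i + j := by
      rw [add_add_add_comm, add_self_bits, add_zero]
    rw [← sgn_add, ← add_dotProduct, hb]
  have h4 : A.symmetrize.eve b i j m = bra b j (WithLp.toLp 2 fun q => sgn (q ⬝ᵥ m) •
      A.U (WithLp.toLp 2 fun q => symS E N (withKet (withPlus N A.probe) b i) q m) (q + m)) := by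
    rw [Attack.eve, bra_coord]
    congr 2
    funext q
    exact symS_symm_coord _ q m
  rw [h4, h2, h1, map_smul, bra_smul, smul_smul, ← h3]
  congr 1
  ring

/-- The probe states of the symmetrized attack for given TEST bits, as a vector indexed by the
error string on the INFO bits. -/
def Attack.symVec (A : Attack N E) (b : BitStr N) (s : Sel N n) (iT jT : BitStr (N - n))
    (i : BitStr n) : Reg (BitStr n) (Reg (BitStr N) E) :=
  WithLp.toLp 2 fun c => A.symmetrize.eve b (join s i iT) (join s (i + c) jT)

/-- The Fourier transform of `Attack.symVec`. -/
def Attack.symFourier (A : Attack N E) (b : BitStr N) (s : Sel N n) (iT jT : BitStr (N - n))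
    (l : BitStr n) : Reg (BitStr n) (Reg (BitStr N) E) :=
  (1 / 2 ^ n : ℂ) • ∑ i, sgn (i ⬝ᵥ l) • A.symVec b s iT jT i

theorem Attack.symVec_eq_sum (A : Attack N E) (b : BitStr N) (s : Sel N n)
    (iT jT : BitStr (N - n)) (i : BitStr n) :
    A.symVec b s iT jT i = ∑ l, sgn (i ⬝ᵥ l) • A.symFourier b s iT jT l := by
  simp only [Attack.symFourier, smul_comm (sgn _) (1 / 2 ^ n : ℂ)]
  rw [← Finset.smul_sum, fourier_inversion, smul_smul, Fintype.card_fin]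
  simp

/-- The substitution i ↦ i + m_I moves the INFO mask out of the probe vector into a sign, while the
TEST mask survives only as a shift of Alice's TEST string. This is the source of the orthogonality
below. -/
theorem Attack.symFourier_coord (A : Attack N E) (b : BitStr N) (s : Sel N n)
    (iT jT : BitStr (N - n)) (l c mI : BitStr n) (mT : BitStr (N - n)) :
    A.symFourier b s iT jT l c (join s mI mT) =
      (1 / 2 ^ n * ((1 / Real.sqrt (2 ^ N) : ℝ) : ℂ) *
        sgn (c ⬝ᵥ mI + (iT + jT) ⬝ᵥ mT) * sgn (mI ⬝ᵥ l)) •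
        A.eveFourier b s (iT + jT) (iT + mT) l c := by
  have h : ∀ i : BitStr n, i + (i + c) = c := fun i => by
    rw [← add_assoc, add_self_bits, zero_add]
  have hT : iT + mT + (iT + jT) = jT + mT := by
    rw [add_add_add_comm, add_self_bits, zero_add, add_comm]
  simp only [Attack.symFourier, Attack.symVec, PiLp.smul_apply, WithLp.ofLp_sum,
    Finset.sum_apply, Attack.eve_symmetrize, join_add, h, join_dotProduct_join,
    Attack.eveFourier, hT]
  rw [← Equiv.sum_comp (Equiv.addRight mI)]
  simp only [Finset.smul_sum, smul_smul, Equiv.coe_addRight]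
  refine Finset.sum_congr rfl fun i _ => ?_
  have h1 : i + mI + mI = i := by rw [add_assoc, add_self_bits, add_zero]
  have h2 : i + mI + c + mI = i + c := by rw [add_right_comm, h1]
  rw [h1, h2, add_dotProduct, sgn_add]
  congr 1
  ring

/-- The sum over the INFO mask is an orthogonality relation of characters in l and l'. On the
diagonal, the TEST mask runs over all TEST strings of Alice, so the value depends on i_T and j_T
only through their sum. -/
theorem Attack.inner_symFourier (A : Attack N E) (b : BitStr N) (s : Sel N n)
    (iT jT : BitStr (N - n)) (l l' : BitStr n) :
    inner ℂ (A.symFourier b s iT jT l) (A.symFourier b s iT jT l') =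
      if l = l' then (A.invErr b s (iT + jT) l : ℂ) else 0 := by
  have hsq : ((1 / Real.sqrt (2 ^ N) : ℝ) : ℂ) * ((1 / Real.sqrt (2 ^ N) : ℝ) : ℂ) = 1 / 2 ^ N := by
    rw [← Complex.ofReal_mul, div_mul_div_comm, Real.mul_self_sqrt (by positivity)]
    simp
  have hterm : ∀ (c mI : BitStr n) (mT : BitStr (N - n)),
      inner ℂ (A.symFourier b s iT jT l c (join s mI mT))
        (A.symFourier b s iT jT l' c (join s mI mT)) =
      (sgn (mI ⬝ᵥ l) * sgn (mI ⬝ᵥ l')) * ((1 / 2 ^ n) * (1 / 2 ^ n) * (1 / 2 ^ N) *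
        inner ℂ (A.eveFourier b s (iT + jT) (iT + mT) l c)
          (A.eveFourier b s (iT + jT) (iT + mT) l' c)) := by
    intro c mI mT
    rw [A.symFourier_coord, A.symFourier_coord, inner_smul_left, inner_smul_right]
    simp only [map_mul, conj_sgn, Complex.conj_ofReal, map_div₀, map_one, map_pow, Complex.conj_ofNat]
    rw [← hsq]
    have := sgn_mul_self (c ⬝ᵥ mI + (iT + jT) ⬝ᵥ mT)
    linear_combination (1 / 2 ^ n * (1 / 2 ^ n) * (((1 / Real.sqrt (2 ^ N) : ℝ) : ℂ) *
      ((1 / Real.sqrt (2 ^ N) : ℝ) : ℂ)) * sgn (mI ⬝ᵥ l) * sgn (mI ⬝ᵥ l') *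
        inner ℂ (A.eveFourier b s (iT + jT) (iT + mT) l c)
          (A.eveFourier b s (iT + jT) (iT + mT) l' c)) * this
  simp only [PiLp.inner_apply, sum_join s, hterm, ← Finset.mul_sum, ← Finset.sum_mul]
  simp only [sum_sgn_mul_sgn, Fintype.card_fin]
  split_ifs with h
  · subst h
    have hshift : ∀ c : BitStr n, ∑ mT, inner ℂ (A.eveFourier b s (iT + jT) (iT + mT) l c)
        (A.eveFourier b s (iT + jT) (iT + mT) l c) =
        ((∑ v, ‖A.eveFourier b s (iT + jT) v l c‖ ^ 2 : ℝ) : ℂ) := by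
      intro c
      have h1 := Equiv.sum_comp (Equiv.addLeft iT)
        fun v => ‖A.eveFourier b s (iT + jT) v l c‖ ^ 2
      rw [← h1, Complex.ofReal_sum]
      refine Finset.sum_congr rfl fun v _ => ?_
      rw [inner_self_eq_norm_sq_to_K, Complex.ofReal_pow]
      rfl
    have hcomm : A.invErr b s (iT + jT) l =
        1 / 2 ^ N * (1 / 2 ^ n) * ∑ c, ∑ v, ‖A.eveFourier b s (iT + jT) v l c‖ ^ 2 := by
      rw [Attack.invErr, Finset.sum_comm]
    simp only [hshift, hcomm, ← Complex.ofReal_sum, Complex.ofReal_mul]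
    push_cast
    field_simp
  · simp

end Attacks

/-! ### Eve's states after symmetrization -/

section Tensor

variable {E : Type*} [NormedAddCommGroup E] [InnerProductSpace ℂ E]
  {X : Type} [Fintype X] [DecidableEq X]

theorem tensorKet_apply (ρ : E →L[ℂ] E) (x : X) (f : Reg X E) :
    tensorKet ρ x f = PiLp.single 2 x (ρ (f x)) := rfl

theorem tensorKet_sum {ι : Type*} (t : Finset ι) (ρ : ι → E →L[ℂ] E) (x : X) :
    tensorKet (∑ i ∈ t, ρ i) x = ∑ i ∈ t, tensorKet (ρ i) x := by
  ext f y
  by_cases h : y = x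
  · subst h
    simp [tensorKet_apply, sum_apply, Finset.sum_apply]
  · simp [tensorKet_apply, sum_apply, Finset.sum_apply, h]

theorem tensorKet_smul (c : ℂ) (ρ : E →L[ℂ] E) (x : X) :
    tensorKet (c • ρ) x = c • tensorKet ρ x := by
  ext f y
  by_cases h : y = x
  · subst h
    simp [tensorKet_apply]
  · simp [tensorKet_apply, h]

theorem tensorKet_sub (ρ ρ' : E →L[ℂ] E) (x : X) :
    tensorKet (ρ - ρ') x = tensorKet ρ x - tensorKet ρ' x := by
  ext f y
  by_cases h : y = x
  · subst h
    simp [tensorKet_apply]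
  · simp [tensorKet_apply, h]

theorem tensorKet_add (ρ ρ' : E →L[ℂ] E) (x : X) :
    tensorKet (ρ + ρ') x = tensorKet ρ x + tensorKet ρ' x := by
  ext f y
  by_cases h : y = x
  · subst h
    simp [tensorKet_apply]
  · simp [tensorKet_apply, h]

theorem tensorKet_rankOne (v w : E) (x : X) :
    tensorKet (InnerProductSpace.rankOne ℂ v w) x =
      InnerProductSpace.rankOne ℂ (PiLp.single 2 x v : Reg X E) (PiLp.single 2 x w) := by
  ext f y
  rw [tensorKet_apply, InnerProductSpace.rankOne_apply, InnerProductSpace.rankOne_apply]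
  have h1 : inner ℂ (PiLp.single 2 x w : Reg X E) f = inner ℂ w (f x) := by
    rw [PiLp.inner_apply, Finset.sum_eq_single x]
    · simp
    · intro z _ hz; simp [hz]
    · simp
  rw [h1]
  by_cases h : y = x
  · subst h
    simp
  · simp [h]

theorem traceLE_tensorKet_rankOne (v w : E) (x : X) :
    TraceLE (tensorKet (InnerProductSpace.rankOne ℂ v w) x) (‖v‖ * ‖w‖) := by
  rw [tensorKet_rankOne]
  simpa using traceLE_rankOne (PiLp.single 2 x v : Reg X E) (PiLp.single 2 x w)

theorem traceLE_zero_smul (D : E →L[ℂ] E) (c : ℝ) : TraceLE (((0 : ℝ) : ℂ) • D) (0 * c) := by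
  rw [Complex.ofReal_zero, zero_smul, zero_mul]
  exact TraceLE.zero

theorem rankOne_self_sub (v w : E) :
    InnerProductSpace.rankOne ℂ v v - InnerProductSpace.rankOne ℂ w w =
      (((1 / 2 : ℝ)) : ℂ) • (InnerProductSpace.rankOne ℂ (v + w) (v - w) +
        InnerProductSpace.rankOne ℂ (v - w) (v + w)) := by
  ext x
  simp only [sub_apply, add_apply, smul_apply, InnerProductSpace.rankOne_apply, inner_add_left,
    inner_sub_left]
  push_cast
  module

/-- By polarization the difference is half of |v+w⟩⟨v-w| plus its adjoint. -/
theorem traceLE_tensorKet_rankOne_self_sub (v w : E) (x : X) :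
    TraceLE (tensorKet (InnerProductSpace.rankOne ℂ v v - InnerProductSpace.rankOne ℂ w w) x)
      (‖v + w‖ * ‖v - w‖) := by
  rw [rankOne_self_sub, tensorKet_smul, tensorKet_add]
  refine (((traceLE_tensorKet_rankOne (v + w) (v - w) x).add
    (traceLE_tensorKet_rankOne (v - w) (v + w) x)).smul
      (by norm_num : (0 : ℝ) ≤ 1 / 2)).mono (le_of_eq ?_)
  ring

theorem isSelfAdjoint_tensorKet_rankOne [CompleteSpace E] (v : E) (x : X) :
    IsSelfAdjoint (tensorKet (InnerProductSpace.rankOne ℂ v v) x) := by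
  rw [tensorKet_rankOne]
  exact (InnerProductSpace.isPositive_rankOne_self _).isSelfAdjoint

theorem isSelfAdjoint_ofReal_smul [CompleteSpace E] {D : E →L[ℂ] E} (hD : IsSelfAdjoint D)
    (c : ℝ) : IsSelfAdjoint ((c : ℂ) • D) :=
  IsSelfAdjoint.smul (Complex.conj_ofReal c) hD

end Tensor

/-! ### Coset sums and their Fourier coefficients -/

open Classical in
/-- The strings with syndrome `ξ` and final key `k`. -/
def KeyMat.coset {n r m : ℕ} (P : KeyMat n r m) (ξ : BitStr r) (k : BitStr m) :
    Finset (BitStr n) :=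
  Finset.univ.filter fun i => i ᵥ* P.1ᵀ = ξ ∧ i ᵥ* P.2ᵀ = k

/-- The weight of `d` on the part of the coset of `l` modulo the row space of `P` that belongs
to the coefficients `z` with `z · a = ε`. -/
def halfWeight {n r m : ℕ} (d : BitStr n → ℝ) (P : KeyMat n r m) (a : Fin r ⊕ Fin m → ZMod 2)
    (ε : ZMod 2) (l : BitStr n) : ℝ :=
  ∑ z with z ⬝ᵥ a = ε, d (l + P.comb z)

theorem dotProduct_comb {n r m : ℕ} (P : KeyMat n r m) (i : BitStr n)
    (z : Fin r ⊕ Fin m → ZMod 2) :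
    i ⬝ᵥ P.comb z = z ⬝ᵥ Sum.elim (i ᵥ* P.1ᵀ) (i ᵥ* P.2ᵀ) := by
  rw [KeyMat.comb_apply, dotProduct_comm, ← Matrix.dotProduct_mulVec, Matrix.fromRows_mulVec,
    Matrix.vecMul_transpose, Matrix.vecMul_transpose]

theorem KeyMat.mem_coset {n r m : ℕ} (P : KeyMat n r m) (ξ : BitStr r) (k : BitStr m)
    (i : BitStr n) :
    i ∈ P.coset ξ k ↔ Sum.elim ξ k = Sum.elim (i ᵥ* P.1ᵀ) (i ᵥ* P.2ᵀ) := by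
  rw [KeyMat.coset, Finset.mem_filter]
  constructor
  · rintro ⟨-, rfl, rfl⟩
    rfl
  · intro h
    exact ⟨Finset.mem_univ _, funext fun p => (congrFun h (Sum.inl p)).symm,
      funext fun p => (congrFun h (Sum.inr p)).symm⟩

section Fourier

variable {n r m : ℕ} {V : Type*} [NormedAddCommGroup V] [InnerProductSpace ℂ V]

/-- Since i·(zP) = z·(i P_Cᵀ, i P_Kᵀ), the character sum over z vanishes unless i has syndrome ξ and
key k. This expresses a coset sum through the Fourier coefficients on one coset of the row space. -/
theorem sum_sgn_comb (P : KeyMat n r m) (ξ : BitStr r) (k : BitStr m) (f : BitStr n → V)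
    (l : BitStr n) :
    ∑ z, sgn (z ⬝ᵥ Sum.elim ξ k) • ((1 / 2 ^ n : ℂ) • ∑ i, sgn (i ⬝ᵥ (l + P.comb z)) • f i) =
      (2 ^ (r + m) / 2 ^ n : ℂ) • ∑ i ∈ P.coset ξ k, sgn (i ⬝ᵥ l) • f i := by
  classical
  have h : ∀ i : BitStr n, ∑ z, sgn (z ⬝ᵥ Sum.elim ξ k) *
      (1 / 2 ^ n * sgn (i ⬝ᵥ (l + P.comb z))) =
      if i ∈ P.coset ξ k then 2 ^ (r + m) / 2 ^ n * sgn (i ⬝ᵥ l) else 0 := by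
    intro i
    have h1 := sum_sgn_mul_sgn (Sum.elim ξ k) (Sum.elim (i ᵥ* P.1ᵀ) (i ᵥ* P.2ᵀ))
    rw [Fintype.card_sum, Fintype.card_fin, Fintype.card_fin] at h1
    have h2 : ∀ z : Fin r ⊕ Fin m → ZMod 2, sgn (z ⬝ᵥ Sum.elim ξ k) *
        (1 / 2 ^ n * sgn (i ⬝ᵥ (l + P.comb z))) = sgn (i ⬝ᵥ l) / 2 ^ n *
        (sgn (z ⬝ᵥ Sum.elim ξ k) * sgn (z ⬝ᵥ Sum.elim (i ᵥ* P.1ᵀ) (i ᵥ* P.2ᵀ))) := by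
      intro z
      rw [dotProduct_add, sgn_add, dotProduct_comb]
      ring
    simp only [h2, ← Finset.mul_sum, h1, P.mem_coset]
    split_ifs
    · ring
    · ring
  simp only [Finset.smul_sum, smul_smul]
  rw [Finset.sum_comm]
  simp only [← Finset.sum_smul, h, ite_smul, zero_smul, Finset.sum_ite_mem, Finset.univ_inter]

/-- Parseval for the function extended by zero outside C. -/
theorem parseval_rankOne_subset (C : Finset (BitStr n)) (f : BitStr n → V) :
    ∑ l : BitStr n, InnerProductSpace.rankOne ℂ (∑ i ∈ C, sgn (i ⬝ᵥ l) • f i)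
        (∑ i ∈ C, sgn (i ⬝ᵥ l) • f i) =
      (2 : ℂ) ^ n • ∑ i ∈ C, InnerProductSpace.rankOne ℂ (f i) (f i) := by
  classical
  have h := parseval_rankOne (fun i => if i ∈ C then f i else 0)
    fun i => if i ∈ C then f i else 0
  have h1 : ∀ i, InnerProductSpace.rankOne ℂ (if i ∈ C then f i else 0)
      (if i ∈ C then f i else 0) =
      if i ∈ C then InnerProductSpace.rankOne ℂ (f i) (f i) else 0 := by
    intro i
    split_ifs <;> simp
  simpa only [smul_ite, smul_zero, Finset.sum_ite_mem, Finset.univ_inter, h1,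
    Fintype.card_fin] using h

/-- Pythagoras; validity of P ensures that different z give different, hence orthogonal, vectors. -/
theorem norm_sq_sum_orthogonal {P : KeyMat n r m} (hP : P.Valid) {f : BitStr n → V}
    {d : BitStr n → ℝ} (hf : ∀ l l', inner ℂ (f l) (f l') = if l = l' then (d l : ℂ) else 0)
    (c : (Fin r ⊕ Fin m → ZMod 2) → ℂ) (l : BitStr n) :
    ‖∑ z, c z • f (l + P.comb z)‖ ^ 2 = ∑ z, ‖c z‖ ^ 2 * d (l + P.comb z) := by
  have h : inner ℂ (∑ z, c z • f (l + P.comb z)) (∑ z, c z • f (l + P.comb z)) =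
      ((∑ z, ‖c z‖ ^ 2 * d (l + P.comb z) : ℝ) : ℂ) := by
    simp only [sum_inner, inner_sum, inner_smul_left, inner_smul_right, hf, add_right_inj,
      hP.comb_injective.eq_iff]
    rw [Complex.ofReal_sum]
    refine Finset.sum_congr rfl fun z _ => ?_
    rw [Finset.sum_eq_single z]
    · simp only [if_true, Complex.ofReal_mul, Complex.ofReal_pow, ← Complex.mul_conj']
      ring
    · intro z' _ hz'
      simp [hz']
    · simp
  simp only [inner_self_eq_norm_sq_to_K, Complex.coe_algebraMap] at h
  exact_mod_cast h

theorem norm_sgn_add_sq (a b : ZMod 2) : ‖sgn a + sgn b‖ ^ 2 = if a + b = 0 then 4 else 0 := by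
  rcases bit_cases a with rfl | rfl <;> rcases bit_cases b with rfl | rfl <;>
    simp [sgn, bit_one_add_one] <;> norm_num

theorem norm_sgn_sub_sq (a b : ZMod 2) : ‖sgn a - sgn b‖ ^ 2 = if a + b = 1 then 4 else 0 := by
  rcases bit_cases a with rfl | rfl <;> rcases bit_cases b with rfl | rfl <;>
    simp [sgn, bit_one_add_one] <;> norm_num

theorem sum_elim_add (ξ : BitStr r) (k k' : BitStr m) :
    (Sum.elim ξ k + Sum.elim ξ k' : Fin r ⊕ Fin m → ZMod 2) =
      Sum.elim (0 : BitStr r) (k + k') := by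
  funext p
  rcases p with p | p
  · exact CharTwo.add_self_eq_zero _
  · rfl

/-- In the expansion over z, the coefficients of the sum and of the difference are the sum and the
difference of two signs. These are 0 or ±2, and the parity of z·(0, k+k') decides which of the two
survives. -/
theorem norm_coset_sum_mul_norm_coset_sum {P : KeyMat n r m} (hP : P.Valid) (ξ : BitStr r)
    (k k' : BitStr m) {f : BitStr n → V} {d : BitStr n → ℝ}
    (hf : ∀ l l', inner ℂ ((1 / 2 ^ n : ℂ) • ∑ i, sgn (i ⬝ᵥ l) • f i)
      ((1 / 2 ^ n : ℂ) • ∑ i, sgn (i ⬝ᵥ l') • f i) = if l = l' then (d l : ℂ) else 0)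
    (l : BitStr n) :
    ‖∑ i ∈ P.coset ξ k, sgn (i ⬝ᵥ l) • f i + ∑ i ∈ P.coset ξ k', sgn (i ⬝ᵥ l) • f i‖ *
      ‖∑ i ∈ P.coset ξ k, sgn (i ⬝ᵥ l) • f i - ∑ i ∈ P.coset ξ k', sgn (i ⬝ᵥ l) • f i‖ =
    4 * (2 ^ n / 2 ^ (r + m)) ^ 2 * (Real.sqrt (halfWeight d P (Sum.elim 0 (k + k')) 0 l) *
      Real.sqrt (halfWeight d P (Sum.elim 0 (k + k')) 1 l)) := by
  set q : ℝ := 2 ^ (r + m) / 2 ^ n with hq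
  have hq0 : 0 < q := by positivity
  have hqc : (2 ^ (r + m) / 2 ^ n : ℂ) = (q : ℂ) := by rw [hq]; push_cast; rfl
  have h1 := sum_sgn_comb P ξ k f l
  have h2 := sum_sgn_comb P ξ k' f l
  rw [hqc] at h1 h2
  set v := ∑ i ∈ P.coset ξ k, sgn (i ⬝ᵥ l) • f i
  set w := ∑ i ∈ P.coset ξ k', sgn (i ⬝ᵥ l) • f i
  have e1 : q * ‖v + w‖ = 2 * Real.sqrt (halfWeight d P (Sum.elim 0 (k + k')) 0 l) := by
    have h3 := norm_sq_sum_orthogonal hP hf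
      (fun z => sgn (z ⬝ᵥ Sum.elim ξ k) + sgn (z ⬝ᵥ Sum.elim ξ k')) l
    simp only [add_smul, Finset.sum_add_distrib, h1, h2, norm_sgn_add_sq, ← dotProduct_add,
      sum_elim_add, ← smul_add, norm_smul, Complex.norm_real, Real.norm_of_nonneg hq0.le] at h3
    rw [← Real.sqrt_sq (by positivity : 0 ≤ q * ‖v + w‖), h3,
      show (2 : ℝ) = Real.sqrt 4 by rw [show (4 : ℝ) = 2 ^ 2 by norm_num]; simp,
      ← Real.sqrt_mul (by norm_num), halfWeight, Finset.sum_filter, Finset.mul_sum]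
    simp only [ite_mul, zero_mul, mul_ite, mul_zero]
  have e2 : q * ‖v - w‖ = 2 * Real.sqrt (halfWeight d P (Sum.elim 0 (k + k')) 1 l) := by
    have h3 := norm_sq_sum_orthogonal hP hf
      (fun z => sgn (z ⬝ᵥ Sum.elim ξ k) - sgn (z ⬝ᵥ Sum.elim ξ k')) l
    simp only [sub_smul, Finset.sum_sub_distrib, h1, h2, norm_sgn_sub_sq, ← dotProduct_add,
      sum_elim_add, ← smul_sub, norm_smul, Complex.norm_real, Real.norm_of_nonneg hq0.le] at h3
    rw [← Real.sqrt_sq (by positivity : 0 ≤ q * ‖v - w‖), h3,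
      show (2 : ℝ) = Real.sqrt 4 by rw [show (4 : ℝ) = 2 ^ 2 by norm_num]; simp,
      ← Real.sqrt_mul (by norm_num), halfWeight, Finset.sum_filter, Finset.mul_sum]
    simp only [ite_mul, zero_mul, mul_ite, mul_zero]
  have hinv : (2 ^ n / 2 ^ (r + m) : ℝ) = q⁻¹ := by rw [hq, inv_div]
  rw [hinv]
  field_simp
  linear_combination (q * ‖v - w‖) * e1 + 
    (2 * Real.sqrt (halfWeight d P (Sum.elim 0 (k + k')) 0 l)) * e2

end Fourier

/-! ### Trace distance of Eve's states for two keys -/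

section Eve

variable {N n r m : ℕ} {E : Type*} [NormedAddCommGroup E] [InnerProductSpace ℂ E]

theorem Attack.norm_sq_symVec (A : Attack N E) (b : BitStr N) (s : Sel N n)
    (iT jT : BitStr (N - n)) (i : BitStr n) :
    ‖A.symVec b s iT jT i‖ ^ 2 = ∑ l, A.invErr b s (iT + jT) l := by
  have h : inner ℂ (A.symVec b s iT jT i) (A.symVec b s iT jT i) =
      ((∑ l, A.invErr b s (iT + jT) l : ℝ) : ℂ) := by
    rw [A.symVec_eq_sum]
    simp only [sum_inner, inner_sum, inner_smul_left, inner_smul_right, A.inner_symFourier,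
      conj_sgn, mul_ite, mul_zero, Finset.sum_ite_eq', Finset.mem_univ, if_true,
      ← mul_assoc, sgn_mul_self, one_mul, Complex.ofReal_sum]
  simp only [inner_self_eq_norm_sq_to_K, Complex.coe_algebraMap] at h
  exact_mod_cast h

/-- The signs drop out of the norm of an orthogonal expansion. Hence the TEST probability does not
depend on the INFO string, and one normalization serves every state in a coset. -/
theorem Attack.testProb_symmetrize (A : Attack N E) (b : BitStr N) (s : Sel N n)
    (iT jT : BitStr (N - n)) (i : BitStr n) :
    A.symmetrize.testProb b s i iT jT = ∑ l, A.invErr b s (iT + jT) l := by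
  rw [← A.norm_sq_symVec b s iT jT i, PiLp.norm_sq_eq_of_L2, Attack.testProb,
    ← Equiv.sum_comp (Equiv.addLeft i)]
  rfl

theorem Attack.rho_symmetrize (A : Attack N E) (b : BitStr N) (s : Sel N n)
    (iT jT : BitStr (N - n)) (i : BitStr n) :
    A.symmetrize.rho b s iT jT i =
      (((1 / Real.sqrt (∑ l, A.invErr b s (iT + jT) l)) ^ 2 : ℝ) : ℂ) •
        ∑ c, InnerProductSpace.rankOne ℂ (A.symVec b s iT jT i c) (A.symVec b s iT jT i c) := by
  rw [Attack.rho, ← Equiv.sum_comp (Equiv.addLeft i), Finset.smul_sum]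
  refine Finset.sum_congr rfl fun c _ => ?_
  have hc : A.symVec b s iT jT i c = A.symmetrize.eve b (join s i iT) (join s (i + c) jT) := rfl
  refine ContinuousLinearMap.ext fun x => ?_
  rw [hc]
  simp only [Attack.eveInfo, A.testProb_symmetrize, InnerProductSpace.rankOne_apply, smul_apply,
    inner_smul_left, smul_smul, Complex.conj_ofReal, Equiv.coe_addLeft]
  rw [Complex.ofReal_pow]
  congr 1
  ring

/-- Parseval replaces the incoherent mixture over the coset by rank-one operators of coherent coset
sums, which can be compared term by term for two keys. -/
theorem Attack.sum_coset_rho (A : Attack N E) (b : BitStr N) (s : Sel N n)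
    (iT jT : BitStr (N - n)) (P : KeyMat n r m) (ξ : BitStr r) (k : BitStr m) :
    ∑ i ∈ P.coset ξ k, A.symmetrize.rho b s iT jT i =
      (((1 / Real.sqrt (∑ l, A.invErr b s (iT + jT) l)) ^ 2 / 2 ^ n : ℝ) : ℂ) •
        ∑ l, ∑ c, InnerProductSpace.rankOne ℂ
          ((∑ i ∈ P.coset ξ k, sgn (i ⬝ᵥ l) • A.symVec b s iT jT i) c)
          ((∑ i ∈ P.coset ξ k, sgn (i ⬝ᵥ l) • A.symVec b s iT jT i) c) := by
  have h1 : ∀ (l c : BitStr n), (∑ i ∈ P.coset ξ k, sgn (i ⬝ᵥ l) • A.symVec b s iT jT i) c =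
      ∑ i ∈ P.coset ξ k, sgn (i ⬝ᵥ l) • A.symVec b s iT jT i c := by
    intro l c
    simp only [WithLp.ofLp_sum, Finset.sum_apply, PiLp.smul_apply]
  rw [Finset.sum_comm]
  simp only [h1, parseval_rankOne_subset, A.rho_symmetrize, ← Finset.smul_sum, smul_smul]
  rw [Finset.sum_comm]
  congr 1
  push_cast
  field_simp

theorem Attack.traceLE_sum_coset_rho_sub (A : Attack N E) (b : BitStr N) (s : Sel N n)
    (iT jT : BitStr (N - n)) {P : KeyMat n r m} (hP : P.Valid) (ξ : BitStr r) (k k' : BitStr m) :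
    TraceLE (tensorKet (∑ i ∈ P.coset ξ k, A.symmetrize.rho b s iT jT i -
        ∑ i ∈ P.coset ξ k', A.symmetrize.rho b s iT jT i) P)
      ((1 / Real.sqrt (∑ l, A.invErr b s (iT + jT) l)) ^ 2 / 2 ^ n *
        ∑ l, 4 * (2 ^ n / 2 ^ (r + m)) ^ 2 *
          (Real.sqrt (halfWeight (A.invErr b s (iT + jT)) P (Sum.elim 0 (k + k')) 0 l) *
           Real.sqrt (halfWeight (A.invErr b s (iT + jT)) P (Sum.elim 0 (k + k')) 1 l))) := by
  rw [A.sum_coset_rho, A.sum_coset_rho, ← smul_sub, tensorKet_smul]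
  refine TraceLE.smul ?_ (by positivity)
  simp only [← Finset.sum_sub_distrib, tensorKet_sum]
  refine TraceLE.sum _ _ _ fun l _ => ?_
  have hf : ∀ l l', inner ℂ ((1 / 2 ^ n : ℂ) • ∑ i, sgn (i ⬝ᵥ l) • A.symVec b s iT jT i)
      ((1 / 2 ^ n : ℂ) • ∑ i, sgn (i ⬝ᵥ l') • A.symVec b s iT jT i) =
      if l = l' then (A.invErr b s (iT + jT) l : ℂ) else 0 := A.inner_symFourier b s iT jT
  rw [← norm_coset_sum_mul_norm_coset_sum hP ξ k k' hf l]
  refine (TraceLE.sum _ _ _ fun c _ => traceLE_tensorKet_rankOne_self_sub _ _ P).mono ?_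
  set v := ∑ i ∈ P.coset ξ k, sgn (i ⬝ᵥ l) • A.symVec b s iT jT i
  set w := ∑ i ∈ P.coset ξ k', sgn (i ⬝ᵥ l) • A.symVec b s iT jT i
  -- Cauchy–Schwarz over the error register c assembles the component norms into the norms of v+w
  -- and v-w.
  refine (Real.sum_mul_le_sqrt_mul_sqrt _ _ _).trans (le_of_eq ?_)
  rw [← Real.sqrt_sq (norm_nonneg (v + w)), ← Real.sqrt_sq (norm_nonneg (v - w)),
    PiLp.norm_sq_eq_of_L2, PiLp.norm_sq_eq_of_L2]
  rfl

theorem Attack.rhoKey_sub (A : Attack N E) (b : BitStr N) (s : Sel N n)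
    (iT jT : BitStr (N - n)) (ξ : BitStr r) (k k' : BitStr m) :
    A.rhoKey b s iT jT ξ k - A.rhoKey b s iT jT ξ k' =
      ((1 / 2 ^ (n - r - m) : ℝ) : ℂ) • ∑ P : KeyMat n r m, ((matProb P : ℝ) : ℂ) •
        tensorKet (∑ i ∈ P.coset ξ k, A.rho b s iT jT i -
          ∑ i ∈ P.coset ξ k', A.rho b s iT jT i) P := by
  rw [Attack.rhoKey, Attack.rhoKey]
  refine (smul_sub _ _ _).symm.trans ?_
  rw [← Finset.sum_sub_distrib]
  congr 1
  refine Finset.sum_congr rfl fun P _ => ?_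
  rw [tensorKet_sub, tensorKet_sum, tensorKet_sum]
  refine Eq.trans ?_ (smul_sub _ _ _).symm
  exact congrArg₂ _ Finset.smul_sum.symm Finset.smul_sum.symm

theorem Attack.isSelfAdjoint_rhoKey [CompleteSpace E] (A : Attack N E) (b : BitStr N)
    (s : Sel N n) (iT jT : BitStr (N - n)) (ξ : BitStr r) (k : BitStr m) :
    IsSelfAdjoint (A.rhoKey b s iT jT ξ k) := by
  refine isSelfAdjoint_ofReal_smul (isSelfAdjoint_sum _ fun P _ => isSelfAdjoint_sum _ fun i _ =>
    isSelfAdjoint_ofReal_smul ?_ _) _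
  rw [Attack.rho, tensorKet_sum]
  exact isSelfAdjoint_sum _ fun j _ => isSelfAdjoint_tensorKet_rankOne _ _

theorem Attack.traceNorm_rhoKey_sub_le [CompleteSpace E] (hrm : r + m ≤ n) (A : Attack N E)
    (b : BitStr N) (s : Sel N n) (iT jT : BitStr (N - n)) (ξ : BitStr r) (k k' : BitStr m) :
    traceNorm (A.symmetrize.rhoKey b s iT jT ξ k - A.symmetrize.rhoKey b s iT jT ξ k') ≤
      ENNReal.ofReal (4 * (1 / Real.sqrt (∑ l, A.invErr b s (iT + jT) l)) ^ 2 *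
        ∑ P : KeyMat n r m, matProb P * (1 / 2 ^ (r + m) *
          ∑ l, Real.sqrt (halfWeight (A.invErr b s (iT + jT)) P (Sum.elim 0 (k + k')) 0 l) *
            Real.sqrt (halfWeight (A.invErr b s (iT + jT)) P (Sum.elim 0 (k + k')) 1 l))) := by
  refine traceNorm_le_of_traceLE ((A.symmetrize.isSelfAdjoint_rhoKey b s iT jT ξ k).sub
    (A.symmetrize.isSelfAdjoint_rhoKey b s iT jT ξ k')) ?_
  rw [Attack.rhoKey_sub]
  have h1 : ∀ P : KeyMat n r m, TraceLE (((matProb P : ℝ) : ℂ) •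
      tensorKet (∑ i ∈ P.coset ξ k, A.symmetrize.rho b s iT jT i -
        ∑ i ∈ P.coset ξ k', A.symmetrize.rho b s iT jT i) P)
      (matProb P * ((1 / Real.sqrt (∑ l, A.invErr b s (iT + jT) l)) ^ 2 / 2 ^ n *
        ∑ l, 4 * (2 ^ n / 2 ^ (r + m)) ^ 2 *
          (Real.sqrt (halfWeight (A.invErr b s (iT + jT)) P (Sum.elim 0 (k + k')) 0 l) *
           Real.sqrt (halfWeight (A.invErr b s (iT + jT)) P (Sum.elim 0 (k + k')) 1 l)))) := by
    intro P
    by_cases hP : P.Valid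
    · exact (A.traceLE_sum_coset_rho_sub b s iT jT hP ξ k k').smul (matProb_nonneg P)
    · rw [matProb_of_not_valid hP]
      exact traceLE_zero_smul _ _
  refine ((TraceLE.sum Finset.univ _ _ fun P _ => h1 P).smul
    (by positivity : (0 : ℝ) ≤ 1 / 2 ^ (n - r - m))).mono (le_of_eq ?_)
  -- The powers combine as 2^{-(n-r-m)} · 2^{-n} · (2^{n-r-m})² = 2^{-(r+m)}.
  have h2 : (2 : ℝ) ^ n = 2 ^ (r + m) * 2 ^ (n - r - m) := by
    rw [← pow_add]; congr 1; omega
  rw [Finset.mul_sum, Finset.mul_sum]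
  refine Finset.sum_congr rfl fun P _ => ?_
  rw [← Finset.mul_sum, h2]
  field_simp

end Eve

/-! ### Averaging over the matrices -/

variable {n r m : ℕ}

theorem halfWeight_nonneg {d : BitStr n → ℝ} (hd : ∀ l, 0 ≤ d l) (P : KeyMat n r m)
    (a : Fin r ⊕ Fin m → ZMod 2) (ε : ZMod 2) (l : BitStr n) : 0 ≤ halfWeight d P a ε l :=
  Finset.sum_nonneg fun _ _ => hd _

theorem halfWeight_add (d : BitStr n → ℝ) (P : KeyMat n r m) (a : Fin r ⊕ Fin m → ZMod 2)
    (l : BitStr n) :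
    halfWeight d P a 0 l + halfWeight d P a 1 l = ∑ z, d (l + P.comb z) := by
  have h : ∀ c : ZMod 2, c = 1 ↔ ¬ c = 0 := by decide
  rw [halfWeight, halfWeight, ← Finset.sum_filter_add_sum_filter_not Finset.univ
    (fun z : Fin r ⊕ Fin m → ZMod 2 => z ⬝ᵥ a = 0)]
  simp only [h]

theorem sum_sum_add_comb (d : BitStr n → ℝ) (P : KeyMat n r m) :
    ∑ l, ∑ z, d (l + P.comb z) = 2 ^ (r + m) * ∑ l, d l := by
  rw [Finset.sum_comm]
  have h : ∀ z, ∑ l, d (l + P.comb z) = ∑ l, d l := fun z =>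
    Equiv.sum_comp (Equiv.addRight (P.comb z)) d
  simp [h]

/-- Some string that is not heavier than `l` and is congruent to `l` modulo the row space of `P`
belongs to the other half of the coset. -/
def KeyMat.Ambiguous (P : KeyMat n r m) (a : Fin r ⊕ Fin m → ZMod 2) (l : BitStr n) : Prop :=
  ∃ u, u ⬝ᵥ a = 1 ∧ hammingNorm (l + P.comb u) ≤ hammingNorm l

-- Pick a lightest string of the coset. Every string in the half not containing it is ambiguous,
-- with that lightest string as witness, so the minimum is bounded by the ambiguous weight of the
-- coset.
open Classical in
theorem min_halfWeight_le {d : BitStr n → ℝ} (hd : ∀ l, 0 ≤ d l) (P : KeyMat n r m)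
    (a : Fin r ⊕ Fin m → ZMod 2) (l : BitStr n) :
    min (halfWeight d P a 0 l) (halfWeight d P a 1 l) ≤
      ∑ z, if P.Ambiguous a (l + P.comb z) then d (l + P.comb z) else 0 := by
  obtain ⟨z₀, hz₀⟩ := Finite.exists_min fun z => hammingNorm (l + P.comb z)
  have key : ∀ ε : ZMod 2, z₀ ⬝ᵥ a + ε = 1 → halfWeight d P a ε l ≤
      ∑ z, if P.Ambiguous a (l + P.comb z) then d (l + P.comb z) else 0 := by
    intro ε hε
    rw [halfWeight, Finset.sum_filter]
    refine Finset.sum_le_sum fun z _ => ?_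
    by_cases hz : z ⬝ᵥ a = ε
    · have hamb : P.Ambiguous a (l + P.comb z) := by
        refine ⟨z₀ + z, by rw [add_dotProduct, hz, hε], ?_⟩
        have : l + P.comb z + P.comb (z₀ + z) = l + P.comb z₀ := by
          rw [map_add, add_comm (P.comb z₀), add_assoc, ← add_assoc (P.comb z), add_self_bits,
            zero_add]
        rw [this]
        exact hz₀ z
      rw [if_pos hz, if_pos hamb]
    · rw [if_neg hz]
      split_ifs
      · exact hd _
      · exact le_rfl
  rcases bit_cases (z₀ ⬝ᵥ a) with h | h
  · exact (min_le_right _ _).trans (key 1 (by rw [h, zero_add]))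
  · exact (min_le_left _ _).trans (key 0 (by rw [h, add_zero]))

open Classical in
theorem sum_min_halfWeight_le {d : BitStr n → ℝ} (hd : ∀ l, 0 ≤ d l) (P : KeyMat n r m)
    (a : Fin r ⊕ Fin m → ZMod 2) :
    ∑ l, min (halfWeight d P a 0 l) (halfWeight d P a 1 l) ≤
      2 ^ (r + m) * ∑ l, if P.Ambiguous a l then d l else 0 :=
  (Finset.sum_le_sum fun l _ => min_halfWeight_le hd P a l).trans
    (sum_sum_add_comb (fun l => if P.Ambiguous a l then d l else 0) P).le

-- Heavy strings are charged the trivial bound 1. If l is lighter than t, a witness x of ambiguity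
-- is also lighter than t, so a union bound over these x applies.
open Classical in
theorem sum_matProb_ambiguous_le (hrm : r + m ≤ n) (hn : n ≠ 0) {t : ℕ}
    (ht : (t : ℝ) ≤ (n : ℝ) / 2) (a : Fin r ⊕ Fin m → ZMod 2) (l : BitStr n) :
    ∑ P : KeyMat n r m, matProb P * (if P.Ambiguous a l then 1 else 0) ≤
      (if t ≤ hammingNorm l then 1 else 0) +
        (2 : ℝ) ^ ((n : ℝ) * H₂ ((t : ℝ) / n)) * (2 ^ (r + m) / 2 ^ n) := by
  by_cases htl : t ≤ hammingNorm l
  · rw [if_pos htl]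
    have h1 : ∑ P : KeyMat n r m, matProb P * (if P.Ambiguous a l then (1 : ℝ) else 0) ≤ 1 := by
      refine le_trans ?_ (sum_matProb hrm).le
      refine Finset.sum_le_sum fun P _ => ?_
      refine mul_le_of_le_one_right (matProb_nonneg P) ?_
      split_ifs <;> norm_num
    have h2 : 0 ≤ (2 : ℝ) ^ ((n : ℝ) * H₂ ((t : ℝ) / n)) * (2 ^ (r + m) / 2 ^ n) := by positivity
    linarith
  · rw [if_neg htl, zero_add]
    set S := (Finset.univ.filter fun x : BitStr n => hammingNorm x < t) with hS
    -- The witness x = l + uP differs from l, because u·a = 1 forces u ≠ 0 and the rows of a valid P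
    -- are independent. Erasing l is what makes l + x nonzero in the estimate of each term.
    have h1 : ∑ P : KeyMat n r m, matProb P * (if P.Ambiguous a l then (1 : ℝ) else 0) ≤
        ∑ x ∈ S.erase l, ∑ P : KeyMat n r m,
          matProb P * (if ∃ u, u ⬝ᵥ a = 1 ∧ P.comb u = l + x then 1 else 0) := by
      rw [Finset.sum_comm]
      refine Finset.sum_le_sum fun P _ => ?_
      rw [← Finset.mul_sum]
      by_cases hP : P.Valid
      · refine mul_le_mul_of_nonneg_left ?_ (matProb_nonneg P)
        split_ifs with h
        · obtain ⟨u, hu, hu'⟩ := h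
          refine le_trans ?_ (Finset.single_le_sum (a := l + P.comb u) (fun w _ => ?_) ?_)
          · rw [if_pos ⟨u, hu, by rw [← add_assoc, add_self_bits, zero_add]⟩]
          · split_ifs <;> norm_num
          · refine Finset.mem_erase.2 ⟨fun h => ?_, Finset.mem_filter.2 ⟨Finset.mem_univ _, ?_⟩⟩
            · have h0 : P.comb u = P.comb 0 := by
                rw [map_zero]
                exact add_eq_left.1 h
              rw [hP.comb_injective h0, zero_dotProduct] at hu
              exact zero_ne_one hu
            · exact hu'.trans_lt (not_le.1 htl)
        · exact Finset.sum_nonneg fun w _ => by split_ifs <;> norm_num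
      · rw [matProb_of_not_valid hP, zero_mul, zero_mul]
    have h2 : ∀ x ∈ S.erase l, ∑ P : KeyMat n r m,
        matProb P * (if ∃ u, u ⬝ᵥ a = 1 ∧ P.comb u = l + x then 1 else 0) ≤
        (2 : ℝ) ^ (r + m) / 2 ^ n := by
      intro x hx
      refine sum_matProb_exists_comb_le hrm hn a fun h => ?_
      exact Finset.ne_of_mem_erase hx (add_eq_zero_iff_bits.1 h).symm
    refine h1.trans ((Finset.sum_le_sum h2).trans ?_)
    rw [Finset.sum_const, nsmul_eq_mul]
    refine mul_le_mul_of_nonneg_right ?_ (by positivity)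
    refine le_trans ?_ (card_weight_lt_le ht)
    exact_mod_cast Finset.card_le_card (Finset.erase_subset _ _)

/-- The product xy is max(x,y) · min(x,y), and max(x,y) ≤ x + y. -/
theorem sqrt_mul_sqrt_le_sqrt_add_mul_sqrt_min {x y : ℝ} (hx : 0 ≤ x) (hy : 0 ≤ y) :
    Real.sqrt x * Real.sqrt y ≤ Real.sqrt (x + y) * Real.sqrt (min x y) := by
  have h1 : x ≤ x + y := by linarith
  have h2 : y ≤ x + y := by linarith
  rcases le_total x y with h | h
  · rw [min_eq_left h, mul_comm]
    exact mul_le_mul_of_nonneg_right (Real.sqrt_le_sqrt h2) (Real.sqrt_nonneg _)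
  · rw [min_eq_right h]
    exact mul_le_mul_of_nonneg_right (Real.sqrt_le_sqrt h1) (Real.sqrt_nonneg _)

/-- Bound for the weighted sum over all cosets, averaged over the matrices. -/
theorem sum_matProb_sqrt_le (hrm : r + m ≤ n) (hn : n ≠ 0) {t : ℕ} (ht : (t : ℝ) ≤ (n : ℝ) / 2)
    {d : BitStr n → ℝ} (hd : ∀ l, 0 ≤ d l) (a : Fin r ⊕ Fin m → ZMod 2) :
    ∑ P : KeyMat n r m, matProb P * (1 / 2 ^ (r + m) *
      ∑ l, Real.sqrt (halfWeight d P a 0 l) * Real.sqrt (halfWeight d P a 1 l)) ≤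
    Real.sqrt (∑ l, d l) * Real.sqrt (∑ l with t ≤ hammingNorm l, d l +
      (∑ l, d l) * ((2 : ℝ) ^ ((n : ℝ) * H₂ ((t : ℝ) / n)) * (2 ^ (r + m) / 2 ^ n))) := by
  classical
  set c : ℝ := (2 : ℝ) ^ ((n : ℝ) * H₂ ((t : ℝ) / n)) * (2 ^ (r + m) / 2 ^ n) with hc
  have hw : ∀ P : KeyMat n r m, 0 ≤ matProb P * (1 / 2 ^ (r + m)) := fun P =>
    mul_nonneg (matProb_nonneg P) (by positivity)
  have h1 : ∑ P : KeyMat n r m, matProb P * (1 / 2 ^ (r + m) *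
      ∑ l, Real.sqrt (halfWeight d P a 0 l) * Real.sqrt (halfWeight d P a 1 l)) ≤
      ∑ x : KeyMat n r m × BitStr n,
        Real.sqrt (matProb x.1 * (1 / 2 ^ (r + m)) *
          (halfWeight d x.1 a 0 x.2 + halfWeight d x.1 a 1 x.2)) *
        Real.sqrt (matProb x.1 * (1 / 2 ^ (r + m)) *
          min (halfWeight d x.1 a 0 x.2) (halfWeight d x.1 a 1 x.2)) := by
    rw [Fintype.sum_prod_type (α₁ := KeyMat n r m) (α₂ := BitStr n)]
    refine Finset.sum_le_sum fun P _ => ?_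
    rw [← mul_assoc, Finset.mul_sum]
    refine Finset.sum_le_sum fun l _ => ?_
    rw [Real.sqrt_mul (hw P), Real.sqrt_mul (hw P),
      mul_mul_mul_comm (Real.sqrt _), Real.mul_self_sqrt (hw P)]
    exact mul_le_mul_of_nonneg_left (sqrt_mul_sqrt_le_sqrt_add_mul_sqrt_min
      (halfWeight_nonneg hd P a 0 l) (halfWeight_nonneg hd P a 1 l)) (hw P)
  -- Cauchy–Schwarz jointly over the matrices and l. The first factor collects the total weight,
  -- since each string lies in 2^{r+m} of the translated row spaces; the second collects the
  -- ambiguous weight.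
  refine h1.trans ((Real.sum_sqrt_mul_sqrt_le _ (fun x => ?_) (fun x => ?_)).trans ?_)
  · have h2 := halfWeight_nonneg hd x.1 a 0 x.2
    have h3 := halfWeight_nonneg hd x.1 a 1 x.2
    exact mul_nonneg (hw _) (add_nonneg h2 h3)
  · exact mul_nonneg (hw _) (le_min (halfWeight_nonneg hd _ _ _ _)
      (halfWeight_nonneg hd _ _ _ _))
  refine mul_le_mul (Real.sqrt_le_sqrt ?_) (Real.sqrt_le_sqrt ?_) (Real.sqrt_nonneg _)
    (Real.sqrt_nonneg _)
  · rw [Fintype.sum_prod_type (α₁ := KeyMat n r m) (α₂ := BitStr n)]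
    simp only [halfWeight_add, ← Finset.mul_sum, sum_sum_add_comb]
    rw [← Finset.sum_mul, ← Finset.sum_mul, sum_matProb hrm]
    refine le_of_eq ?_
    field_simp
  · rw [Fintype.sum_prod_type (α₁ := KeyMat n r m) (α₂ := BitStr n)]
    calc ∑ P : KeyMat n r m, ∑ l, matProb P * (1 / 2 ^ (r + m)) *
          min (halfWeight d P a 0 l) (halfWeight d P a 1 l)
        ≤ ∑ P : KeyMat n r m, matProb P * ∑ l, if P.Ambiguous a l then d l else 0 := by
          refine Finset.sum_le_sum fun P _ => ?_
          rw [← Finset.mul_sum, mul_assoc]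
          refine mul_le_mul_of_nonneg_left ?_ (matProb_nonneg P)
          rw [one_div_mul_eq_div, div_le_iff₀ (by positivity), mul_comm _ ((2 : ℝ) ^ (r + m))]
          exact sum_min_halfWeight_le hd P a
      _ = ∑ l, d l * ∑ P : KeyMat n r m, matProb P * (if P.Ambiguous a l then 1 else 0) := by
          simp only [Finset.mul_sum]
          rw [Finset.sum_comm]
          refine Finset.sum_congr rfl fun l _ => Finset.sum_congr rfl fun P _ => ?_
          split_ifs <;> ring
      _ ≤ ∑ l, d l * ((if t ≤ hammingNorm l then 1 else 0) + c) :=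
          Finset.sum_le_sum fun l _ => mul_le_mul_of_nonneg_left
            (sum_matProb_ambiguous_le hrm hn ht a l) (hd l)
      _ = ∑ l with t ≤ hammingNorm l, d l + (∑ l, d l) * c := by
          simp only [mul_add, Finset.sum_add_distrib, Finset.sum_mul, Finset.sum_filter, mul_ite,
            mul_one, mul_zero]

/-! ### Probabilities -/

section Normalization

variable {N n : ℕ} {E : Type*} [NormedAddCommGroup E] [InnerProductSpace ℂ E]

theorem sum_norm_qubitAmp_sq (b i : ZMod 2) : ∑ q, ‖qubitAmp b i q‖ ^ 2 = 1 := by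
  have hu : (Finset.univ : Finset (ZMod 2)) = {0, 1} := by decide
  rw [hu, Finset.sum_pair (by decide)]
  rcases bit_cases b with rfl | rfl <;> rcases bit_cases i with rfl | rfl <;>
    simp [qubitAmp, norm_sgn] <;> norm_num

theorem sum_norm_ketAmp_sq (b i : BitStr N) : ∑ q, ‖ketAmp b i q‖ ^ 2 = 1 := by
  simp only [ketAmp, norm_prod, ← Finset.prod_pow]
  rw [← Fintype.piFinset_univ, ← Finset.prod_univ_sum (fun _ => Finset.univ)
    (fun p a => ‖qubitAmp (b p) (i p) a‖ ^ 2)]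
  simp only [sum_norm_qubitAmp_sq, Finset.prod_const_one]

theorem norm_withKet (e : E) (b i : BitStr N) : ‖withKet e b i‖ = ‖e‖ := by
  rw [← sq_eq_sq₀ (norm_nonneg _) (norm_nonneg _), PiLp.norm_sq_eq_of_L2]
  simp only [withKet, norm_smul, mul_pow, ← Finset.sum_mul, sum_norm_ketAmp_sq, one_mul]

theorem sum_norm_bra_sq (b : BitStr N) (f : Reg (BitStr N) E) :
    ∑ j, ‖bra b j f‖ ^ 2 = ‖f‖ ^ 2 := by
  have h : ∑ j, inner ℂ (bra b j f) (bra b j f) = ∑ q, inner ℂ (f q) (f q) := by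
    simp only [bra, sum_inner, inner_sum, inner_smul_left, inner_smul_right,
      RingHomCompTriple.comp_apply, RingHom.id_apply, Finset.mul_sum, ← mul_assoc]
    rw [Finset.sum_comm]
    refine Finset.sum_congr rfl fun q _ => ?_
    rw [Finset.sum_comm]
    have h1 : ∀ q', ∑ j, (starRingEnd ℂ) (ketAmp b j q) * ketAmp b j q' =
        if q' = q then 1 else 0 := by
      intro q'
      rw [← sum_ketAmp b q' q]
      exact Finset.sum_congr rfl fun j _ => mul_comm _ _
    simp only [← Finset.sum_mul, h1, ite_mul, zero_mul, one_mul]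
    simp
  rw [PiLp.norm_sq_eq_of_L2]
  simp only [inner_self_eq_norm_sq_to_K, Complex.coe_algebraMap] at h
  exact_mod_cast h

theorem Attack.sum_norm_eve_sq (A : Attack N E) (b i : BitStr N) :
    ∑ j, ‖A.eve b i j‖ ^ 2 = 1 := by
  simp only [Attack.eve, sum_norm_bra_sq, LinearIsometryEquiv.norm_map, norm_withKet,
    A.norm_probe, one_pow]

theorem sum_join_error {M : Type*} [AddCommMonoid M] (s : Sel N n) (f : BitStr N → BitStr N → M) :
    ∑ i, ∑ j, f i j =
      ∑ cT, ∑ l, ∑ v, ∑ u, f (join s u v) (join s (u + l) (v + cT)) := by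
  have h1 : ∀ u v, ∑ j, f (join s u v) j = ∑ cT, ∑ l, f (join s u v) (join s (u + l) (v + cT)) := by
    intro u v
    rw [sum_join s, ← Equiv.sum_comp (Equiv.addLeft u), Finset.sum_comm,
      ← Equiv.sum_comp (Equiv.addLeft v)]
    rfl
  rw [sum_join s]
  simp only [h1]
  rw [Finset.sum_comm]
  refine (Finset.sum_congr rfl fun v _ => Finset.sum_comm).trans ?_
  rw [Finset.sum_comm]
  refine Finset.sum_congr rfl fun cT _ => ?_
  refine (Finset.sum_congr rfl fun v _ => Finset.sum_comm).trans ?_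
  exact Finset.sum_comm

theorem Attack.sum_invErr (A : Attack N E) (b : BitStr N) (s : Sel N n) :
    ∑ cT, ∑ l, A.invErr b s cT l = 1 := by
  simp only [← A.sum_eve_add_sel, ← Finset.mul_sum]
  rw [← sum_join_error s fun i j => ‖A.eve (b + s.1) i j‖ ^ 2]
  simp [A.sum_norm_eve_sq]

end Normalization

/-! ### Summation over runs of the protocol -/

section Prob

variable {N n r m : ℕ} {E : Type*} [NormedAddCommGroup E] [InnerProductSpace ℂ E]

theorem sum_run {M : Type*} [AddCommMonoid M] (f : Run N n r m → M) :
    ∑ ω, f ω = ∑ b, ∑ s, ∑ P, ∑ i, ∑ j, f ⟨i, j, b, s, P⟩ := by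
  let e : BitStr N × Sel N n × KeyMat n r m × BitStr N × BitStr N ≃ Run N n r m :=
    { toFun := fun x => ⟨x.2.2.2.1, x.2.2.2.2, x.1, x.2.1, x.2.2.1⟩
      invFun := fun ω => (ω.b, ω.s, ω.P, ω.i, ω.j)
      left_inv := fun _ => rfl
      right_inv := fun _ => rfl }
  rw [← e.sum_comp]
  simp only [Fintype.sum_prod_type]
  rfl

/-- Each run has exactly one syndrome, and the law of the matrices sums to 1. The syndrome can thus
be summed out once the trace distance is bounded uniformly in ξ. -/
theorem Protocol.sum_Pr_syndrome (hrm : r + m ≤ n) (Q : Protocol N n) (A : Attack N E)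
    (iT jT : BitStr (N - n)) (b : BitStr N) (s : Sel N n) :
    ∑ ξ : BitStr r, Q.Pr A {ω : Run N n r m | testPart ω.s ω.i = iT ∧ testPart ω.s ω.j = jT ∧
      ω.b = b ∧ ω.s = s ∧ ω.syndrome = ξ} =
      1 / 2 ^ N * Q.prob b s * ∑ u, A.testProb b s u iT jT := by
  classical
  have h1 : ∑ ξ : BitStr r, Q.Pr A {ω : Run N n r m | testPart ω.s ω.i = iT ∧
      testPart ω.s ω.j = jT ∧ ω.b = b ∧ ω.s = s ∧ ω.syndrome = ξ} =
      ∑ ω : Run N n r m, if ω.b = b then if ω.s = s then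
        if testPart ω.s ω.i = iT then if testPart ω.s ω.j = jT then
          Q.runProb A (fun b _ => b) ω else 0 else 0 else 0 else 0 := by
    simp only [Protocol.Pr, Finset.sum_filter]
    rw [Finset.sum_comm]
    refine Finset.sum_congr rfl fun ω _ => ?_
    rw [Finset.sum_eq_single ω.syndrome]
    · simp only [Set.mem_ofPred_eq, and_true, ite_and]
      split_ifs <;> rfl
    · intro ξ _ hξ
      rw [if_neg]
      rintro ⟨-, -, -, -, h⟩
      exact hξ h.symm
    · simp
  rw [h1, sum_run, Finset.sum_eq_single b, Finset.sum_eq_single s]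
  rotate_left
  · intro s' _ hs'
    simp [hs']
  · simp
  · intro b' _ hb'
    simp [hb']
  · simp
  simp only [if_true, sum_join s, testPart_join, Protocol.runProb, Attack.testProb]
  have h2 : ∀ (P : KeyMat n r m), ∑ u : BitStr n, ∑ v, ∑ u₂ : BitStr n, ∑ v₂,
      (if v = iT then if v₂ = jT then 1 / 2 ^ N * Q.prob b s * matProb P *
        ‖A.eve b (join s u v) (join s u₂ v₂)‖ ^ 2 else 0 else 0) =
      matProb P * (1 / 2 ^ N * Q.prob b s * ∑ u, ∑ u₂,
        ‖A.eve b (join s u iT) (join s u₂ jT)‖ ^ 2) := by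
    intro P
    simp only [Finset.mul_sum]
    refine Finset.sum_congr rfl fun u _ => ?_
    rw [Finset.sum_eq_single iT]
    · refine Finset.sum_congr rfl fun u₂ _ => ?_
      rw [Finset.sum_eq_single jT]
      · rw [if_pos rfl, if_pos rfl]
        ring
      · intro v₂ _ h
        rw [if_pos rfl, if_neg h]
      · simp
    · intro v _ h
      simp [h]
    · simp
  rw [Finset.sum_congr rfl fun P _ => h2 P, ← Finset.sum_mul, sum_matProb hrm, one_mul]

theorem Protocol.PrInv_eq (hrm : r + m ≤ n) (hn : n ≠ 0) (Q : Protocol N n) (A : Attack N E)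
    (t : ℕ) :
    Q.PrInv A {ω : Run N n r m |
        (hammingNorm (infoPart ω.s ω.c) : ℝ) / n ≥ (t : ℝ) / n ∧ Q.Passes ω} =
      ∑ b, ∑ s, ∑ cT, if Q.T cT (testPart s b) s = true then
        Q.prob b s * ∑ l with t ≤ hammingNorm l, A.invErr b s cT l else 0 := by
  classical
  have hn' : (0 : ℝ) < n := by exact_mod_cast Nat.pos_of_ne_zero hn
  rw [Protocol.PrInv, Finset.sum_filter, sum_run]
  refine Finset.sum_congr rfl fun b _ => Finset.sum_congr rfl fun s _ => ?_
  have h : ∀ P : KeyMat n r m, ∑ i, ∑ j, (if (⟨i, j, b, s, P⟩ : Run N n r m) ∈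
      {ω : Run N n r m | (hammingNorm (infoPart ω.s ω.c) : ℝ) / n ≥ (t : ℝ) / n ∧ Q.Passes ω}
      then Q.runProb A (fun b s => b + s.1) ⟨i, j, b, s, P⟩ else 0) =
      matProb P * ∑ cT, if Q.T cT (testPart s b) s = true then
        Q.prob b s * ∑ l with t ≤ hammingNorm l, A.invErr b s cT l else 0 := by
    intro P
    rw [sum_join_error s, Finset.mul_sum]
    refine Finset.sum_congr rfl fun cT _ => ?_
    have hc : ∀ (u l : BitStr n) (v : BitStr (N - n)),
        join s u v + join s (u + l) (v + cT) = join s l cT := by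
      intro u l v
      rw [join_add, ← add_assoc, add_self_bits, zero_add, ← add_assoc, add_self_bits, zero_add]
    simp only [Set.mem_ofPred_eq, Run.c, Protocol.Passes, hc, infoPart_join, testPart_join,
      ge_iff_le, div_le_div_iff_of_pos_right hn', Nat.cast_le, Protocol.runProb]
    by_cases hT : Q.T cT (testPart s b) s = true
    · simp only [hT, and_true, if_true, ← A.sum_eve_add_sel, Finset.mul_sum, Finset.sum_filter]
      refine Finset.sum_congr rfl fun l _ => ?_
      split_ifs
      · simp only [Finset.mul_sum]
        refine Finset.sum_congr rfl fun v _ => Finset.sum_congr rfl fun u _ => ?_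
        ring
      · simp
    · simp [hT]
  refine (Finset.sum_congr rfl fun P _ => Eq.trans ?_ (h P)).trans ?_
  · refine Finset.sum_congr rfl fun i _ => Finset.sum_congr rfl fun j _ => ?_
    congr
  · rw [← Finset.sum_mul, sum_matProb hrm, one_mul]

/-- Cauchy–Schwarz for the mean over the basis strings and the TEST error strings. -/
theorem Protocol.sum_sqrt_le (Q : Protocol N n) {c : ℝ} (hc : 0 ≤ c)
    (q R : BitStr N → Sel N n → BitStr (N - n) → ℝ) (hq : ∀ b s cT, 0 ≤ q b s cT)
    (hR : ∀ b s cT, 0 ≤ R b s cT) (hsum : ∀ b s, ∑ cT, q b s cT = 1) :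
    ∑ b, ∑ s, ∑ cT, (if Q.T cT (testPart s b) s = true then Q.prob b s *
        (Real.sqrt (q b s cT) * Real.sqrt (R b s cT + q b s cT * c)) else 0) ≤
      Real.sqrt (∑ b, ∑ s, ∑ cT, (if Q.T cT (testPart s b) s = true then
        Q.prob b s * R b s cT else 0) + c) := by
  have h1 : ∑ b, ∑ s, ∑ cT, Q.prob b s * q b s cT = 1 := by
    simp only [← Finset.mul_sum, hsum, mul_one, Q.prob_sum]
  have h2 : ∑ b, ∑ s, ∑ cT, (if Q.T cT (testPart s b) s = true then Q.prob b s *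
        (Real.sqrt (q b s cT) * Real.sqrt (R b s cT + q b s cT * c)) else 0) ≤
      ∑ x : BitStr N × Sel N n × BitStr (N - n),
        Real.sqrt (Q.prob x.1 x.2.1 * q x.1 x.2.1 x.2.2) *
        Real.sqrt ((if Q.T x.2.2 (testPart x.2.1 x.1) x.2.1 = true then
          Q.prob x.1 x.2.1 * R x.1 x.2.1 x.2.2 else 0) +
            Q.prob x.1 x.2.1 * q x.1 x.2.1 x.2.2 * c) := by
    simp only [Fintype.sum_prod_type]
    refine Finset.sum_le_sum fun b _ => Finset.sum_le_sum fun s _ => Finset.sum_le_sum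
      fun cT _ => ?_
    split_ifs
    · have hp := Q.prob_nonneg b s
      rw [mul_assoc, ← mul_add, Real.sqrt_mul hp, Real.sqrt_mul hp,
        mul_mul_mul_comm (Real.sqrt (Q.prob b s)),
        Real.mul_self_sqrt hp]
    · positivity
  refine h2.trans ((Real.sum_sqrt_mul_sqrt_le _ (fun x => ?_) (fun x => ?_)).trans ?_)
  · exact mul_nonneg (Q.prob_nonneg _ _) (hq _ _ _)
  · refine add_nonneg ?_ (mul_nonneg (mul_nonneg (Q.prob_nonneg _ _) (hq _ _ _)) hc)
    split_ifs
    · exact mul_nonneg (Q.prob_nonneg _ _) (hR _ _ _)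
    · exact le_rfl
  · simp only [Fintype.sum_prod_type, Finset.sum_add_distrib, ← Finset.sum_mul, h1,
      Real.sqrt_one, one_mul, le_refl]

/-! ### The expected trace distance -/

variable [CompleteSpace E]

/-- The bound for the trace distance does not involve ξ. The probabilities therefore add up to
2^{n-N} Pr(b,s) q, where q is the TEST error probability, and this q cancels the normalization of
Eve's states. -/
theorem Protocol.sum_delta_mul_le (hrm : r + m ≤ n) (hn : n ≠ 0) (Q : Protocol N n)
    (A : Attack N E) (k k' : BitStr m) {t : ℕ} (ht : (t : ℝ) ≤ (n : ℝ) / 2)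
    (iT jT : BitStr (N - n)) (b : BitStr N) (s : Sel N n) :
    ∑ ξ : BitStr r, Q.delta A.symmetrize k k' iT jT b s ξ *
      ENNReal.ofReal (Q.Pr A.symmetrize {ω : Run N n r m | testPart ω.s ω.i = iT ∧
        testPart ω.s ω.j = jT ∧ ω.b = b ∧ ω.s = s ∧ ω.syndrome = ξ}) ≤
      ENNReal.ofReal (2 * 2 ^ n / 2 ^ N * if Q.T (iT + jT) (testPart s b) s = true then
        Q.prob b s * (Real.sqrt (∑ l, A.invErr b s (iT + jT) l) *
          Real.sqrt (∑ l with t ≤ hammingNorm l, A.invErr b s (iT + jT) l +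
            (∑ l, A.invErr b s (iT + jT) l) *
              ((2 : ℝ) ^ ((n : ℝ) * H₂ ((t : ℝ) / n)) * (2 ^ (r + m) / 2 ^ n)))) else 0) := by
  by_cases hT : Q.T (iT + jT) (testPart s b) s = true
  swap
  · simp [Protocol.delta, hT]
  have hd : ∀ l, 0 ≤ A.invErr b s (iT + jT) l := A.invErr_nonneg b s (iT + jT)
  have hS := sum_matProb_sqrt_le hrm hn ht hd (Sum.elim 0 (k + k'))
  set q := ∑ l, A.invErr b s (iT + jT) l with hq
  set S := ∑ P : KeyMat n r m, matProb P * (1 / 2 ^ (r + m) *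
    ∑ l, Real.sqrt (halfWeight (A.invErr b s (iT + jT)) P (Sum.elim 0 (k + k')) 0 l) *
      Real.sqrt (halfWeight (A.invErr b s (iT + jT)) P (Sum.elim 0 (k + k')) 1 l)) with hSdef
  set B := Real.sqrt q * Real.sqrt (∑ l with t ≤ hammingNorm l, A.invErr b s (iT + jT) l +
    q * ((2 : ℝ) ^ ((n : ℝ) * H₂ ((t : ℝ) / n)) * (2 ^ (r + m) / 2 ^ n)))
  have hq0 : 0 ≤ q := Finset.sum_nonneg fun l _ => hd l
  have hB0 : 0 ≤ B := by positivity
  have hpr : ∀ ξ : BitStr r, 0 ≤ Q.Pr A.symmetrize {ω : Run N n r m | testPart ω.s ω.i = iT ∧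
        testPart ω.s ω.j = jT ∧ ω.b = b ∧ ω.s = s ∧ ω.syndrome = ξ} := fun ξ =>
    Finset.sum_nonneg fun ω _ => mul_nonneg (mul_nonneg (mul_nonneg (by positivity)
      (Q.prob_nonneg _ _)) (matProb_nonneg _)) (by positivity)
  have hdelta : ∀ ξ : BitStr r, Q.delta A.symmetrize k k' iT jT b s ξ ≤
      ENNReal.ofReal (2 * (1 / Real.sqrt q) ^ 2 * B) := by
    intro ξ
    rw [Protocol.delta, if_pos hT]
    refine (mul_le_mul_right (A.traceNorm_rhoKey_sub_le hrm b s iT jT ξ k k') 2⁻¹).trans ?_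
    have h2 : (2⁻¹ : ℝ≥0∞) = ENNReal.ofReal (1 / 2) := by
      rw [one_div, ENNReal.ofReal_inv_of_pos (by norm_num)]
      simp
    rw [h2, ← ENNReal.ofReal_mul (by norm_num)]
    refine ENNReal.ofReal_le_ofReal ?_
    rw [← hSdef, ← hq]
    have := mul_le_mul_of_nonneg_left hS (by positivity : 0 ≤ 2 * (1 / Real.sqrt q) ^ 2)
    linarith
  rw [if_pos hT]
  calc _ ≤ ∑ ξ : BitStr r, ENNReal.ofReal (2 * (1 / Real.sqrt q) ^ 2 * B) *
        ENNReal.ofReal (Q.Pr A.symmetrize {ω : Run N n r m | testPart ω.s ω.i = iT ∧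
        testPart ω.s ω.j = jT ∧ ω.b = b ∧ ω.s = s ∧ ω.syndrome = ξ}) :=
        Finset.sum_le_sum fun ξ _ => mul_le_mul_left (hdelta ξ) _
    _ = ENNReal.ofReal (2 * (1 / Real.sqrt q) ^ 2 * B *
          (1 / 2 ^ N * Q.prob b s * (2 ^ n * q))) := by
        have hsum : ∑ u, A.symmetrize.testProb b s u iT jT = 2 ^ n * q := by
          simp [A.testProb_symmetrize, hq]
        rw [← Finset.mul_sum, ← ENNReal.ofReal_sum_of_nonneg fun ξ _ => hpr ξ,
          Q.sum_Pr_syndrome hrm, hsum,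
          ENNReal.ofReal_mul (p := 2 * (1 / Real.sqrt q) ^ 2 * B) (by positivity)]
    _ ≤ _ := by
        refine ENNReal.ofReal_le_ofReal ?_
        -- An inequality only because of q = 0, where the left side is 0.
        have h3 : (1 / Real.sqrt q) ^ 2 * q ≤ 1 := by
          rw [div_pow, one_pow, Real.sq_sqrt hq0, one_div]
          exact inv_mul_le_one
        have h4 : 0 ≤ 2 * 2 ^ n / 2 ^ N * (Q.prob b s * B) :=
          mul_nonneg (by positivity) (mul_nonneg (Q.prob_nonneg b s) hB0)
        have h5 := mul_le_mul_of_nonneg_left h3 h4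
        refine le_trans (le_of_eq ?_) (h5.trans (mul_one _).le)
        ring

/-- The summand depends on i_T and j_T only through c_T = i_T ⊕ j_T. The free sum over i_T gives
2^{N-n}, which cancels the prefactor 2^n/2^N, and Cauchy–Schwarz over b, s, c_T finishes. -/
theorem Protocol.expectedDelta_le (hrm : r + m ≤ n) (hnN : n < N) (hn : n ≠ 0)
    (Q : Protocol N n) (A : Attack N E) (k k' : BitStr m) {t : ℕ} (ht : (t : ℝ) ≤ (n : ℝ) / 2) :
    Q.expectedDelta A.symmetrize r k k' ≤
      ENNReal.ofReal (2 * Real.sqrt (Q.PrInv A {ω : Run N n r m |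
            (hammingNorm (infoPart ω.s ω.c) : ℝ) / n ≥ (t : ℝ) / n ∧ Q.Passes ω} +
          (2 : ℝ) ^ ((n : ℝ) * H₂ ((t : ℝ) / n)) * (2 ^ (r + m) / 2 ^ n))) := by
  set c : ℝ := (2 : ℝ) ^ ((n : ℝ) * H₂ ((t : ℝ) / n)) * (2 ^ (r + m) / 2 ^ n) with hc
  let F : BitStr N → Sel N n → BitStr (N - n) → ℝ := fun b s cT =>
    if Q.T cT (testPart s b) s = true then
        Q.prob b s * (Real.sqrt (∑ l, A.invErr b s cT l) *
          Real.sqrt (∑ l with t ≤ hammingNorm l, A.invErr b s cT l +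
            (∑ l, A.invErr b s cT l) * c)) else 0
  have hF0 : ∀ b s cT, 0 ≤ F b s cT := by
    intro b s cT
    simp only [F]
    split_ifs
    · exact mul_nonneg (Q.prob_nonneg _ _) (by positivity)
    · exact le_rfl
  have h1 : Q.expectedDelta A.symmetrize r k k' ≤
      ∑ iT : BitStr (N - n), ∑ jT : BitStr (N - n), ∑ b : BitStr N, ∑ s : Sel N n,
        ENNReal.ofReal (2 * 2 ^ n / 2 ^ N * F b s (iT + jT)) :=
    Finset.sum_le_sum fun iT _ => Finset.sum_le_sum fun jT _ => Finset.sum_le_sum fun b _ =>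
      Finset.sum_le_sum fun s _ => Q.sum_delta_mul_le hrm hn A k k' ht iT jT b s
  refine h1.trans ?_
  have hF1 : ∀ b s cT, 0 ≤ 2 * 2 ^ n / 2 ^ N * F b s cT := fun b s cT =>
    mul_nonneg (by positivity) (hF0 b s cT)
  have h2 : ∑ iT : BitStr (N - n), ∑ jT : BitStr (N - n), ∑ b : BitStr N, ∑ s : Sel N n,
      ENNReal.ofReal (2 * 2 ^ n / 2 ^ N * F b s (iT + jT)) =
      ENNReal.ofReal (2 * ∑ b, ∑ s, ∑ cT, F b s cT) := by
    have h3 : ∑ iT : BitStr (N - n), ∑ jT : BitStr (N - n), ∑ b : BitStr N, ∑ s : Sel N n,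
        2 * 2 ^ n / 2 ^ N * F b s (iT + jT) = 2 * ∑ b, ∑ s, ∑ cT, F b s cT := by
      have h4 : ∀ iT : BitStr (N - n), ∑ jT : BitStr (N - n), ∑ b : BitStr N, ∑ s : Sel N n,
          2 * 2 ^ n / 2 ^ N * F b s (iT + jT) =
          2 * 2 ^ n / 2 ^ N * ∑ b, ∑ s, ∑ cT, F b s cT := by
        intro iT
        have h5 := Equiv.sum_comp (Equiv.addLeft iT)
          fun cT => ∑ b : BitStr N, ∑ s : Sel N n, 2 * 2 ^ n / 2 ^ N * F b s cT
        refine h5.trans ?_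
        simp only [← Finset.mul_sum]
        rw [Finset.sum_comm]
        congr 1
        exact Finset.sum_congr rfl fun b _ => Finset.sum_comm
      have h6 : (2 : ℝ) ^ N = 2 ^ (N - n) * 2 ^ n := by
        rw [← pow_add]; congr 1; omega
      rw [Finset.sum_congr rfl fun iT _ => h4 iT, Finset.sum_const, nsmul_eq_mul,
        Finset.card_univ, Fintype.card_fun, ZMod.card, Fintype.card_fin, h6]
      push_cast
      field_simp
    rw [← h3]
    rw [ENNReal.ofReal_sum_of_nonneg fun iT _ => Finset.sum_nonneg fun jT _ =>
      Finset.sum_nonneg fun b _ => Finset.sum_nonneg fun s _ => hF1 _ _ _]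
    refine Finset.sum_congr rfl fun iT _ => ?_
    rw [ENNReal.ofReal_sum_of_nonneg fun jT _ =>
      Finset.sum_nonneg fun b _ => Finset.sum_nonneg fun s _ => hF1 _ _ _]
    refine Finset.sum_congr rfl fun jT _ => ?_
    rw [ENNReal.ofReal_sum_of_nonneg fun b _ => Finset.sum_nonneg fun s _ => hF1 _ _ _]
    refine Finset.sum_congr rfl fun b _ => ?_
    rw [ENNReal.ofReal_sum_of_nonneg fun s _ => hF1 _ _ _]
  rw [h2, Q.PrInv_eq hrm hn]
  refine ENNReal.ofReal_le_ofReal (mul_le_mul_of_nonneg_left ?_ (by norm_num))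
  exact Q.sum_sqrt_le (by positivity) (fun b s cT => ∑ l, A.invErr b s cT l)
    (fun b s cT => ∑ l with t ≤ hammingNorm l, A.invErr b s cT l)
    (fun b s cT => Finset.sum_nonneg fun l _ => A.invErr_nonneg b s cT l)
    (fun b s cT => Finset.sum_nonneg fun l _ => A.invErr_nonneg b s cT l) (A.sum_invErr)

theorem Protocol.expectedDelta_self (Q : Protocol N n) (A : Attack N E) (k : BitStr m) :
    Q.expectedDelta A r k k = 0 := by
  have h : ∀ (iT jT : BitStr (N - n)) (b : BitStr N) (s : Sel N n) (ξ : BitStr r),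
      Q.delta A k k iT jT b s ξ = 0 := by
    intro iT jT b s ξ
    rw [Protocol.delta, sub_self]
    have h0 := traceNorm_le_of_traceLE (IsSelfAdjoint.zero _)
      (TraceLE.zero (H := Reg (KeyMat n r m) E))
    rw [ENNReal.ofReal_zero, nonpos_iff_eq_zero] at h0
    rw [h0, mul_zero, ite_self]
  simp [Protocol.expectedDelta, h]

end Prob

end GenBB84

end

theorem mainTheorem4 {N n r m : ℕ} (hrm : r + m ≤ n) (hnN : n < N)
    (Q : GenBB84.Protocol N n)
    {E : Type*} [NormedAddCommGroup E] [InnerProductSpace ℂ E] [CompleteSpace E]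
    (A : GenBB84.Attack N E)
    (k k' : GenBB84.BitStr m) (t : ℕ) (ht : (t : ℝ) ≤ (n : ℝ) / 2) :
    Q.expectedDelta A.symmetrize r k k' ≤
      ENNReal.ofReal (2 * m * Real.sqrt
        (Q.PrInv A {ω : GenBB84.Run N n r m |
            (hammingNorm (GenBB84.infoPart ω.s ω.c) : ℝ) / n ≥ (t : ℝ) / n ∧ Q.Passes ω}
          + (2 : ℝ) ^ ((n : ℝ) * (GenBB84.H₂ ((t : ℝ) / n) - ((n : ℝ) - r - m) / n)))) := by
  -- For m = 0 there is only one key, so the distance vanishes.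
  rcases Nat.eq_zero_or_pos m with rfl | hm
  · rw [Subsingleton.elim k' k, GenBB84.Protocol.expectedDelta_self]
    exact zero_le
  have hn : n ≠ 0 := by omega
  have hn' : (n : ℝ) ≠ 0 := by exact_mod_cast hn
  have hpow : (2 : ℝ) ^ ((n : ℝ) * (GenBB84.H₂ ((t : ℝ) / n) - ((n : ℝ) - r - m) / n)) =
      (2 : ℝ) ^ ((n : ℝ) * GenBB84.H₂ ((t : ℝ) / n)) * (2 ^ (r + m) / 2 ^ n) := by
    rw [mul_sub, mul_div_cancel₀ _ hn', ← Real.rpow_natCast, ← Real.rpow_natCast,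
      ← Real.rpow_sub two_pos, ← Real.rpow_add two_pos]
    congr 1
    push_cast
    ring
  rw [hpow]
  refine (Q.expectedDelta_le hrm hnN hn A k k' ht).trans (ENNReal.ofReal_le_ofReal ?_)
  -- The factor m is pure slack here: 2 ≤ 2m.
  have hm' : (1 : ℝ) ≤ m := by exact_mod_cast hm
  exact mul_le_mul_of_nonneg_right (by linarith) (Real.sqrt_nonneg _)
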